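/- Let $k$ be a field of characteristic $0$. Let ${\frak g}_1,\dots,{\frak g}_q$ be finite dimensional simple Lie algebras over $k$; for each $i$ let $m_i\ge 1$, let $\varepsilon_i\in k$ be a primitive $m_i$-th root of unity, and let $\alpha_i$ be an automorphism of ${\frak g}_i$ with $\alpha_i^{m_i}=1$. For $n\in{\Bbb Z}$ let ${\frak g}_{i,n}$ be the eigenspace of $\alpha_i$ for the eigenvalue $\varepsilon_i^n$ (it depends only on $n$ modulo $m_i$). Let $$L=\bigoplus_{i=1}^q\Bigl(\bigoplus_{n\in{\Bbb Z}}{\frak g}_{i,n}\otimes t^n\ \oplus\ k c_i\ \oplus\ k d_i\Bigr)$$ be the associated (twisted) affine Kac–Moody Lie algebra, the direct sum over $i$ of Lie algebras in which $c_i$ is central, $[d_i,x t^a]=a\,x t^a$ and $[xt^a,yt^b]=[x,y]t^{a+b}+a\,\delta_{a+b,0}\,\kappa_i(x,y)\,c_i$, where $\kappa_i$ is the Killing form of ${\frak g}_i$. Assume that $L$ has no infinite dimensional abelian quotients. Give $t^n$ degree $n$ and $c_i,d_i$ degree $0$, let $L_r$ ($r\in{\Bbb Z}$) be the span of the elements of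 degree $\ge r$, and put $m=\max_i m_i$. The subalgebra $L_0$ is the positive part of $L$, with the filtration $(L_r)_{r\ge 0}$. For a finite extension $K$ of $k$, a subspace $H$ of $L_0\otimes K$ (or of $L\otimes K$) is closed if $H=\bigcap_r (H+L_r\otimes K)$. A subspace $H$ of $L\otimes K$ is commensurable with $L_0\otimes K$ if $H\cap (L_0\otimes K)$ has finite codimension in $H$ and in $L_0\otimes K$; its codimension is then the sum of these two codimensions. For $*\in\{\le,\triangleleft\}$ let ${\cal X}^*(L_0)$ be the class which to $K$ attaches the set of closed $K$-subalgebras ($*={\le}$), respectively of closed ideals ($*={\triangleleft}$), of $L_0\otimes K$; and let ${\cal X}^*_0(L)$ be the class which to $K$ attaches the set of closed subalgebras, respectively of closed ideals, of $L\otimes K$ that are commensurable with $L_0\otimes K$. For such a class ${\cal X}$ and $l,n\in{\Bbb N}$ let $A_{l,n}({\cal X})$ consist of the $H\in{\cal X}(K)$, $K$ any finite extension of $k$, of codimension $n$ with $H\supseteq L_l\otimes K$ and, for ${\cal X}={\cal X}_0^*(L)$, also $H\subseteq L_{-l}\otimes K$. It is regarded as a set of points of the Grassmannian of $L_0/L_l$,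 respectively of $L_{-l}/L_l$. The class ${\cal X}$ is called stable if all $A_{l,n}({\cal X})$ are constructible subsets of these Grassmannians and if for every $n$ there is an $l$ such that $A_{j,n}({\cal X})=A_{l,n}({\cal X})$ for all $j\ge l$. Then, for $*\in\{\le,\triangleleft\}$, ${\cal X}^*(L_0)$ and ${\cal X}_0^*(L)$ are stable classes of subalgebras. Moreover, for every $n$ and every finite extension $K$ of $k$, every $H$ of codimension $n$ in ${\cal X}^{\le}(L_0)(K)$ or in ${\cal X}_0^{\le}(L)(K)$ contains $L_{2nm}\otimes K$. -/

import Mathlib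

open scoped TensorProduct DirectSum

universe u v w

noncomputable section

/-! ### The affine Lie algebra `𝔤 ⊗ k[t, t⁻¹] ⊕ k c ⊕ k d` -/

section Loop

variable (k : Type u) [Field k] (𝔤 : Type v) [LieRing 𝔤] [LieAlgebra k 𝔤]

/-- The bracket of polynomial loops `∑ xₙ tⁿ` (finitely supported functions `ℤ →₀ 𝔤`):
`[x t ^ a, y t ^ b] = [x, y] t ^ (a + b)`. -/
def loopBracket : (ℤ →₀ 𝔤) →ₗ[k] (ℤ →₀ 𝔤) →ₗ[k] (ℤ →₀ 𝔤) :=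
  Finsupp.lsum k fun a : ℤ => LinearMap.flip (Finsupp.lsum k fun b : ℤ =>
    ((LieModule.toEnd k 𝔤 𝔤 : 𝔤 →ₗ[k] Module.End k 𝔤).compr₂ (Finsupp.lsingle (a + b))).flip)

/-- The derivation `t d/dt` of polynomial loops: `x t ^ a ↦ a x t ^ a`. -/
def loopDeriv : (ℤ →₀ 𝔤) →ₗ[k] (ℤ →₀ 𝔤) :=
  Finsupp.lsum k fun a : ℤ => (a : k) • Finsupp.lsingle a

/-- The 2-cocycle of polynomial loops `ω(x t ^ a, y t ^ b) = a δ_{a + b, 0} κ(x, y)`, with `κ`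
the Killing form of `𝔤`. -/
def loopCocycle : (ℤ →₀ 𝔤) →ₗ[k] (ℤ →₀ 𝔤) →ₗ[k] k :=
  Finsupp.lsum k fun a : ℤ => LinearMap.flip (Finsupp.lsum k fun b : ℤ =>
    if a + b = 0 then (a : k) • (killingForm k 𝔤).flip else 0)

/-- The underlying space `𝔤 ⊗ k[t, t⁻¹] ⊕ k c ⊕ k d` of the affine Lie algebra. -/
@[ext] structure AffineLie where
  /-- the polynomial loop -/
  loop : ℤ →₀ 𝔤
  /-- the coefficient of the central element `c` -/
  c : k
  /-- the coefficient of the derivation `d` -/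
  d : k

end Loop

section LoopLemmas

variable {k : Type u} [Field k] {𝔤 : Type v} [LieRing 𝔤] [LieAlgebra k 𝔤]

@[simp] theorem loopBracket_single (a b : ℤ) (x y : 𝔤) :
    loopBracket k 𝔤 (Finsupp.single a x) (Finsupp.single b y) = Finsupp.single (a + b) ⁅x, y⁆ := by
  simp [loopBracket]

theorem loopBracket_apply (f g : ℤ →₀ 𝔤) (n : ℤ) :
    loopBracket k 𝔤 f g n =
      ∑ a ∈ f.support, ∑ b ∈ g.support, if a + b = n then ⁅f a, g b⁆ else 0 := by
  have h : loopBracket k 𝔤 f g =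
      ∑ a ∈ f.support, ∑ b ∈ g.support, Finsupp.single (a + b) ⁅f a, g b⁆ := by
    conv_lhs => rw [← Finsupp.sum_single f, ← Finsupp.sum_single g]
    simp only [Finsupp.sum, map_sum, LinearMap.sum_apply, loopBracket_single]
    exact Finset.sum_comm
  rw [h]
  simp only [Finsupp.finsetSum_apply, Finsupp.single_apply]

@[simp] theorem loopDeriv_single (a : ℤ) (x : 𝔤) :
    loopDeriv k 𝔤 (Finsupp.single a x) = (a : k) • Finsupp.single a x := by
  simp [loopDeriv]

theorem loopDeriv_apply (f : ℤ →₀ 𝔤) (n : ℤ) : loopDeriv k 𝔤 f n = (n : k) • f n := by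
  induction f using Finsupp.induction_linear with
  | zero => simp
  | add f g hf hg => simp [hf, hg]
  | single a x =>
    rw [loopDeriv_single]
    by_cases h : a = n
    · subst h; simp
    · simp [h]

@[simp] theorem loopCocycle_single (a b : ℤ) (x y : 𝔤) :
    loopCocycle k 𝔤 (Finsupp.single a x) (Finsupp.single b y) =
      if a + b = 0 then (a : k) * killingForm k 𝔤 x y else 0 := by
  simp only [loopCocycle, Finsupp.lsum_single, LinearMap.flip_apply]
  split_ifs <;> simp

theorem loopBracket_skew (f g : ℤ →₀ 𝔤) : loopBracket k 𝔤 f g = -loopBracket k 𝔤 g f := by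
  induction f using Finsupp.induction_linear with
  | zero => simp
  | add f f' hf hf' => simp only [map_add, LinearMap.add_apply, hf, hf']; abel
  | single a x =>
    induction g using Finsupp.induction_linear with
    | zero => simp
    | add g g' hg hg' => simp only [map_add, LinearMap.add_apply, hg, hg']; abel
    | single b y =>
      rw [loopBracket_single, loopBracket_single, add_comm b a, ← Finsupp.single_neg, lie_skew]

theorem loopBracket_self (f : ℤ →₀ 𝔤) : loopBracket k 𝔤 f f = 0 := by
  induction f using Finsupp.induction_linear with
  | zero => simp
  | add f g hf hg =>
    simp only [map_add, LinearMap.add_apply, hf, hg]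
    rw [loopBracket_skew f g]
    abel
  | single a x => simp

theorem loopBracket_leibniz (f g h : ℤ →₀ 𝔤) :
    loopBracket k 𝔤 f (loopBracket k 𝔤 g h) =
      loopBracket k 𝔤 (loopBracket k 𝔤 f g) h + loopBracket k 𝔤 g (loopBracket k 𝔤 f h) := by
  induction f using Finsupp.induction_linear with
  | zero => simp
  | add f f' hf hf' => simp only [map_add, LinearMap.add_apply, hf, hf']; abel
  | single a x =>
    induction g using Finsupp.induction_linear with
    | zero => simp
    | add g g' hg hg' => simp only [map_add, LinearMap.add_apply, hg, hg']; abel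
    | single b y =>
      induction h using Finsupp.induction_linear with
      | zero => simp
      | add h h' hh hh' => simp only [map_add, hh, hh']; abel
      | single e z =>
        simp only [loopBracket_single]
        rw [show b + (a + e) = a + (b + e) by ring, show a + b + e = a + (b + e) by ring,
          ← Finsupp.single_add, ← leibniz_lie]

theorem loopDeriv_bracket (f g : ℤ →₀ 𝔤) :
    loopDeriv k 𝔤 (loopBracket k 𝔤 f g) =
      loopBracket k 𝔤 (loopDeriv k 𝔤 f) g + loopBracket k 𝔤 f (loopDeriv k 𝔤 g) := by
  induction f using Finsupp.induction_linear with
  | zero => simp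
  | add f f' hf hf' => simp only [map_add, LinearMap.add_apply, hf, hf']; abel
  | single a x =>
    induction g using Finsupp.induction_linear with
    | zero => simp
    | add g g' hg hg' => simp only [map_add, hg, hg']; abel
    | single b y =>
      simp only [loopBracket_single, loopDeriv_single, map_smul, LinearMap.smul_apply, ← add_smul]
      push_cast
      rfl

theorem loopCocycle_skew (f g : ℤ →₀ 𝔤) : loopCocycle k 𝔤 f g = -loopCocycle k 𝔤 g f := by
  induction f using Finsupp.induction_linear with
  | zero => simp
  | add f f' hf hf' => simp only [map_add, LinearMap.add_apply, hf, hf']; ring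
  | single a x =>
    induction g using Finsupp.induction_linear with
    | zero => simp
    | add g g' hg hg' => simp only [map_add, LinearMap.add_apply, hg, hg']; ring
    | single b y =>
      rw [loopCocycle_single, loopCocycle_single, LieModule.traceForm_comm k 𝔤 𝔤 y x, add_comm b a]
      split_ifs with h
      · rw [show b = -a by lia]; push_cast; ring
      · simp

theorem loopCocycle_self (f : ℤ →₀ 𝔤) : loopCocycle k 𝔤 f f = 0 := by
  induction f using Finsupp.induction_linear with
  | zero => simp
  | add f g hf hg =>
    simp only [map_add, LinearMap.add_apply, hf, hg]
    rw [loopCocycle_skew f g]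
    ring
  | single a x =>
    rw [loopCocycle_single]
    split_ifs with h
    · rw [show a = 0 by lia]; simp
    · rfl

theorem loopCocycle_deriv (f g : ℤ →₀ 𝔤) :
    loopCocycle k 𝔤 (loopDeriv k 𝔤 f) g + loopCocycle k 𝔤 f (loopDeriv k 𝔤 g) = 0 := by
  induction f using Finsupp.induction_linear with
  | zero => simp
  | add f f' hf hf' =>
    simp only [map_add, LinearMap.add_apply]
    linear_combination hf + hf'
  | single a x =>
    induction g using Finsupp.induction_linear with
    | zero => simp
    | add g g' hg hg' =>
      simp only [map_add]
      linear_combination hg + hg'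
    | single b y =>
      simp only [loopDeriv_single, map_smul, LinearMap.smul_apply, loopCocycle_single, smul_eq_mul]
      split_ifs with h
      · rw [show b = -a by lia]; push_cast; ring
      · simp

theorem loopCocycle_bracket (f g h : ℤ →₀ 𝔤) :
    loopCocycle k 𝔤 f (loopBracket k 𝔤 g h) =
      loopCocycle k 𝔤 (loopBracket k 𝔤 f g) h + loopCocycle k 𝔤 g (loopBracket k 𝔤 f h) := by
  induction f using Finsupp.induction_linear with
  | zero => simp
  | add f f' hf hf' => simp only [map_add, LinearMap.add_apply, hf, hf']; ring
  | single a x =>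
    induction g using Finsupp.induction_linear with
    | zero => simp
    | add g g' hg hg' => simp only [map_add, LinearMap.add_apply, hg, hg']; ring
    | single b y =>
      induction h using Finsupp.induction_linear with
      | zero => simp
      | add h h' hh hh' => simp only [map_add, hh, hh']; ring
      | single e z =>
        simp only [loopBracket_single, loopCocycle_single]
        rw [show b + (a + e) = a + (b + e) by ring, show a + b + e = a + (b + e) by ring]
        split_ifs with h
        · have h1 : killingForm k 𝔤 ⁅x, y⁆ z = killingForm k 𝔤 x ⁅y, z⁆ :=
            LieModule.traceForm_apply_lie_apply k 𝔤 𝔤 x y z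
          have h2 : killingForm k 𝔤 y ⁅x, z⁆ = -killingForm k 𝔤 x ⁅y, z⁆ := by
            rw [← h1, ← lie_skew x y, map_neg, LinearMap.neg_apply, neg_neg]
            exact (LieModule.traceForm_apply_lie_apply k 𝔤 𝔤 y x z).symm
          rw [h1, h2]
          push_cast
          ring
        · simp

end LoopLemmas

namespace AffineLie

variable {k : Type u} [Field k] {𝔤 : Type v} [LieRing 𝔤]

/-- The coordinates of an element of the affine Lie algebra. -/
def equivProd : AffineLie k 𝔤 ≃ (ℤ →₀ 𝔤) × k × k where
  toFun z := (z.loop, z.c, z.d)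
  invFun p := ⟨p.1, p.2.1, p.2.2⟩
  left_inv _ := rfl
  right_inv _ := rfl

instance : AddCommGroup (AffineLie k 𝔤) := equivProd.addCommGroup


@[simp] theorem loop_zero : (0 : AffineLie k 𝔤).loop = 0 := rfl
@[simp] theorem c_zero : (0 : AffineLie k 𝔤).c = 0 := rfl
@[simp] theorem d_zero : (0 : AffineLie k 𝔤).d = 0 := rfl
@[simp] theorem loop_add (z z' : AffineLie k 𝔤) : (z + z').loop = z.loop + z'.loop := rfl
@[simp] theorem c_add (z z' : AffineLie k 𝔤) : (z + z').c = z.c + z'.c := rfl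
@[simp] theorem d_add (z z' : AffineLie k 𝔤) : (z + z').d = z.d + z'.d := rfl

variable [LieAlgebra k 𝔤]

instance : Module k (AffineLie k 𝔤) := equivProd.module k

@[simp] theorem loop_smul (r : k) (z : AffineLie k 𝔤) : (r • z).loop = r • z.loop := rfl
@[simp] theorem c_smul (r : k) (z : AffineLie k 𝔤) : (r • z).c = r * z.c := rfl
@[simp] theorem d_smul (r : k) (z : AffineLie k 𝔤) : (r • z).d = r * z.d := rfl

/-- `[f + a c + b d, f' + a' c + b' d] = [f, f'] + b t f'_t - b' t f_t + ω(f, f') c`: the element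
`c` is central and `d` acts on loops as `t d/dt`. -/
instance : Bracket (AffineLie k 𝔤) (AffineLie k 𝔤) where
  bracket z z' :=
    ⟨loopBracket k 𝔤 z.loop z'.loop + z.d • loopDeriv k 𝔤 z'.loop - z'.d • loopDeriv k 𝔤 z.loop,
      loopCocycle k 𝔤 z.loop z'.loop, 0⟩

@[simp] theorem loop_lie (z z' : AffineLie k 𝔤) : ⁅z, z'⁆.loop =
    loopBracket k 𝔤 z.loop z'.loop + z.d • loopDeriv k 𝔤 z'.loop - z'.d • loopDeriv k 𝔤 z.loop :=
  rfl
@[simp] theorem c_lie (z z' : AffineLie k 𝔤) : ⁅z, z'⁆.c = loopCocycle k 𝔤 z.loop z'.loop := rfl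
@[simp] theorem d_lie (z z' : AffineLie k 𝔤) : ⁅z, z'⁆.d = 0 := rfl

instance : LieRing (AffineLie k 𝔤) where
  add_lie x y z := by
    ext1
    · simp only [loop_lie, loop_add, d_add, map_add, LinearMap.add_apply, add_smul, smul_add]
      abel
    · simp
    · simp
  lie_add x y z := by
    ext1
    · simp only [loop_lie, loop_add, d_add, map_add, add_smul, smul_add]
      abel
    · simp
    · simp
  lie_self x := by
    ext1
    · simp [loopBracket_self]
    · simp [loopCocycle_self]
    · simp
  leibniz_lie x y z := by
    ext1
    · simp only [loop_lie, loop_add, d_lie, map_add, map_sub, map_smul, LinearMap.add_apply,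
        LinearMap.sub_apply, LinearMap.smul_apply, loopDeriv_bracket, zero_smul,
        loopBracket_leibniz x.loop y.loop z.loop, smul_add, smul_sub]
      rw [loopBracket_skew y.loop (loopDeriv k 𝔤 x.loop), smul_comm x.d y.d, smul_comm x.d z.d,
        smul_comm y.d z.d]
      simp only [smul_neg]
      abel
    · simp only [c_lie, c_add, loop_lie, map_add, map_sub, map_smul, LinearMap.add_apply,
        LinearMap.sub_apply, LinearMap.smul_apply, smul_eq_mul,
        loopCocycle_bracket x.loop y.loop z.loop]
      have h1 := loopCocycle_deriv (k := k) x.loop y.loop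
      have h2 := loopCocycle_deriv (k := k) x.loop z.loop
      have h3 := loopCocycle_deriv (k := k) y.loop z.loop
      have h4 := loopCocycle_skew (k := k) y.loop (loopDeriv k 𝔤 x.loop)
      linear_combination y.d * h2 - x.d * h3 - z.d * h1 + z.d * h4
    · simp

instance : LieAlgebra k (AffineLie k 𝔤) where
  lie_smul r x y := by
    ext1
    · simp only [loop_lie, loop_smul, d_smul, map_smul, smul_add, smul_sub, mul_smul]
      rw [smul_comm x.d r]
    · simp
    · simp

end AffineLie

section AffineKacMoody

variable {k : Type u} [Field k]

/-- The affine algebra `L_(σ)𝔤 ⊕ k c ⊕ k d` of the twisted loop algebra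
`L_(σ)𝔤 = ⨁ₙ 𝔤ₙ ⊗ tⁿ`, where `𝔤ₙ` is the eigenspace of the automorphism `σ` for the
eigenvalue `εⁿ`. It is used with `ε` a primitive `m`-th root of unity and `σ ^ m = 1`, where `𝔤ₙ`
depends only on `n` modulo `m`; `m = 1` is the untwisted case. -/
def twistedAffine {𝔤 : Type v} [LieRing 𝔤] [LieAlgebra k 𝔤] (ε : kˣ) (σ : 𝔤 ≃ₗ⁅k⁆ 𝔤) :
    LieSubalgebra k (AffineLie k 𝔤) where
  carrier := {z | ∀ n : ℤ, σ (z.loop n) = ((ε ^ n : kˣ) : k) • z.loop n}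
  zero_mem' n := by simp
  add_mem' hz hz' n := by simp [hz n, hz' n]
  smul_mem' r z hz n := by
    simp only [AffineLie.loop_smul, Finsupp.smul_apply, map_smul, hz n]
    rw [smul_comm]
  lie_mem' {z z'} hz hz' n := by
    have h : ∀ f g : ℤ →₀ 𝔤, (∀ n : ℤ, σ (f n) = ((ε ^ n : kˣ) : k) • f n) →
        (∀ n : ℤ, σ (g n) = ((ε ^ n : kˣ) : k) • g n) →
        σ (loopBracket k 𝔤 f g n) = ((ε ^ n : kˣ) : k) • loopBracket k 𝔤 f g n := by
      intro f g hf hg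
      simp only [loopBracket_apply, map_sum, Finset.smul_sum]
      refine Finset.sum_congr rfl fun a _ => Finset.sum_congr rfl fun b _ => ?_
      split_ifs with hab
      · rw [LieEquiv.map_lie, hf, hg, smul_lie, lie_smul, smul_smul, ← Units.val_mul, ← zpow_add,
          hab]
      · simp
    simp only [AffineLie.loop_lie, Finsupp.sub_apply, Finsupp.add_apply, Finsupp.smul_apply,
      loopDeriv_apply, map_sub, map_add, map_smul, h _ _ hz hz', hz n, hz' n, smul_sub, smul_add]
    simp only [smul_smul]
    ring_nf

variable {ι : Type w} [Fintype ι] (𝔤 : ι → Type v) [∀ i, LieRing (𝔤 i)] [∀ i, LieAlgebra k (𝔤 i)]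
  (ε : ι → kˣ) (σ : ∀ i, 𝔤 i ≃ₗ⁅k⁆ 𝔤 i)

/-- The (in general twisted) affine Kac-Moody algebra attached to the semisimple Lie algebra
`⨁ᵢ 𝔤ᵢ` and the automorphisms `σᵢ`: the product over the simple factors of the algebras
`L_(σᵢ)𝔤ᵢ ⊕ k cᵢ ⊕ k dᵢ`. -/
abbrev AffineKM : Type (max w v u) := ⨁ i, twistedAffine (k := k) (ε i) (σ i)

/-- The term `L_r` of the `ℤ`-filtration by degree in `t`: all coefficients of `t ^ n`, `n < r`,
vanish; the elements `cᵢ` and `dᵢ` have degree `0`. -/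
def affineFiltration (r : ℤ) : Submodule k (AffineKM 𝔤 ε σ) where
  carrier := {z | ∀ i, (∀ n < r, (z i : AffineLie k (𝔤 i)).loop n = 0) ∧
    (0 < r → (z i : AffineLie k (𝔤 i)).c = 0 ∧ (z i : AffineLie k (𝔤 i)).d = 0)}
  zero_mem' i := by simp
  add_mem' {z z'} hz hz' i := by
    refine ⟨fun n hn => ?_, fun hr => ?_⟩
    · simp [(hz i).1 n hn, (hz' i).1 n hn]
    · simp [(hz i).2 hr, (hz' i).2 hr]
  smul_mem' a z hz i := by
    refine ⟨fun n hn => ?_, fun hr => ?_⟩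
    · rw [DirectSum.smul_apply]
      simp [(hz i).1 n hn]
    · rw [DirectSum.smul_apply]
      simp [(hz i).2 hr]

/-- The positive part `L_0` of the affine Kac-Moody algebra, the span of the terms of
degree `≥ 0`. -/
def affinePositivePart : LieSubalgebra k (AffineKM 𝔤 ε σ) where
  __ := affineFiltration 𝔤 ε σ 0
  lie_mem' {z z'} hz hz' i := by
    refine ⟨fun n hn => ?_, fun hr => absurd hr (lt_irrefl 0)⟩
    have h1 := (hz i).1
    have h2 := (hz' i).1
    simp only [DirectSum.bracket_apply, LieSubalgebra.coe_bracket, AffineLie.loop_lie,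
      Finsupp.sub_apply, Finsupp.add_apply, Finsupp.smul_apply, loopDeriv_apply, h1 n hn, h2 n hn,
      smul_zero, add_zero, sub_zero, loopBracket_apply]
    refine Finset.sum_eq_zero fun a _ => Finset.sum_eq_zero fun b _ => ?_
    split_ifs with hab
    · rcases lt_or_ge a 0 with ha | ha
      · rw [h1 a ha, zero_lie]
      · rw [h2 b (by lia), lie_zero]
    · rfl

/-- The `ℕ`-filtration of the positive part. -/
def affinePositiveFiltration (r : ℕ) : Submodule k (affinePositivePart 𝔤 ε σ) :=
  (affineFiltration 𝔤 ε σ r).comap (affinePositivePart 𝔤 ε σ).toSubmodule.subtype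

end AffineKacMoody

/-! ### Classes of subalgebras of filtered Lie algebras -/

section Classes

/-- A class of subalgebras of the `k`-Lie algebra `L`: for every finite extension `K` of `k`, a
family of `K`-subalgebras of `L ⊗ K`. -/
def SubalgebraClass (k : Type u) [Field k] (L : Type v) [LieRing L] [LieAlgebra k L] :
    Type (max (u + 1) v) :=
  ∀ (K : Type u) [Field K] [Algebra k K] [FiniteDimensional k K], Set (LieSubalgebra K (K ⊗[k] L))

/-- A family of sets of `K`-subspaces of `V ⊗ K`, one set for every finite extension `K` of `k`;
for finite dimensional `V` these are sets of points of the Grassmannian of `V`. -/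
def SubspaceFamily (k : Type u) [Field k] (V : Type v) [AddCommGroup V] [Module k V] :
    Type (max (u + 1) v) :=
  ∀ (K : Type u) [Field K] [Algebra k K] [FiniteDimensional k K], Set (Submodule K (K ⊗[k] V))

/-- The closed point of the affine space `𝔸^τ` over `k` underlying a point with coordinates in a
finite extension `K` of `k`. -/
def affinePoint {k : Type u} [Field k] {K : Type u} [Field K] [Algebra k K] {τ : Type}
    (x : τ → K) : PrimeSpectrum (MvPolynomial τ k) :=
  PrimeSpectrum.comap (MvPolynomial.aeval x : MvPolynomial τ k →ₐ[k] K).toRingHom ⊥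

/-- The point with coordinates `x` in the affine chart of the Grassmannian of `V` given by a basis
`b` of `V` divided into two parts of sizes `p` and `q`: the row space of the block matrix
`(1 | x)`. All standard charts of `Gr(p, V)` arise in this way. -/
def grassmannianChart {k : Type u} [Field k] {V : Type v} [AddCommGroup V] [Module k V] {p q : ℕ}
    (b : Module.Basis (Fin p ⊕ Fin q) k V) (K : Type u) [Field K] [Algebra k K]
    (x : Fin p × Fin q → K) : Submodule K (K ⊗[k] V) :=
  Submodule.span K (Set.range fun i : Fin p =>
    (1 : K) ⊗ₜ[k] b (Sum.inl i) + ∑ j : Fin q, x (i, j) ⊗ₜ[k] b (Sum.inr j))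

/-- `V` is finite dimensional and the family `S` is a constructible subset of the Grassmannian
of `V`: its intersection with every affine chart is a constructible subset of the affine space. -/
def IsConstructibleFamily {k : Type u} [Field k] {V : Type v} [AddCommGroup V] [Module k V]
    (S : SubspaceFamily k V) : Prop :=
  FiniteDimensional k V ∧
  ∀ (p q : ℕ) (b : Module.Basis (Fin p ⊕ Fin q) k V),
    ∃ Z : Set (PrimeSpectrum (MvPolynomial (Fin p × Fin q) k)), Topology.IsConstructible Z ∧
      ∀ (K : Type u) [Field K] [Algebra k K] [FiniteDimensional k K] (x : Fin p × Fin q → K),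
        grassmannianChart b K x ∈ S K ↔ affinePoint x ∈ Z

variable {k : Type u} [Field k] {L : Type v} [LieRing L] [LieAlgebra k L]

/-- The subspace of `(B / A) ⊗ K` defined by a subspace `H` of `L ⊗ K` with
`A ⊗ K ⊆ H ⊆ B ⊗ K`. -/
def subquotientPoint (A B : Submodule k L) (K : Type u) [Field K] [Algebra k K]
    (H : Submodule K (K ⊗[k] L)) : Submodule K (K ⊗[k] (B ⧸ A.submoduleOf B)) :=
  (H.comap (B.subtype.baseChange K)).map ((A.submoduleOf B).mkQ.baseChange K)

/-- `H` is closed for the topology in which the subspaces `F j` are a neighbourhood base of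
zero. -/
def IsClosedSubspace {K : Type u} [Field K] {M : Type v} [AddCommGroup M] [Module K M]
    {J : Type} (F : J → Submodule K M) (H : Submodule K M) : Prop :=
  ⨅ j, (H ⊔ F j) = H

/-- The class `𝒳^≤` of closed subalgebras. -/
def closedSubalgebras {J : Type} (F : J → Submodule k L) : SubalgebraClass k L :=
  fun K _ _ _ => {H | IsClosedSubspace (fun j => (F j).baseChange K) H.toSubmodule}

/-- The class `𝒳^◁` of closed subalgebras which are ideals. -/
def closedIdeals {J : Type} (F : J → Submodule k L) : SubalgebraClass k L :=
  fun K _ _ _ => {H | H ∈ closedSubalgebras F K ∧ ∀ x : K ⊗[k] L, ∀ y ∈ H, ⁅x, y⁆ ∈ H}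

/-- Two subspaces are commensurable if their intersection has finite codimension in both. -/
def IsCommensurableWith {K : Type u} [Field K] {M : Type v} [AddCommGroup M] [Module K M]
    (H N : Submodule K M) : Prop :=
  FiniteDimensional K (H ⧸ N.submoduleOf H) ∧ FiniteDimensional K (N ⧸ H.submoduleOf N)

/-- For a `ℤ`-filtration `F` and a class `X`, the subclass `X_0` of subalgebras commensurable
with `F 0`. -/
def commensurableIn (F : ℤ → Submodule k L) (X : SubalgebraClass k L) : SubalgebraClass k L :=
  fun K _ _ _ => {H | H ∈ X K ∧ IsCommensurableWith H.toSubmodule ((F 0).baseChange K)}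

/-- `A_n(X)`: the members of `X` of codimension `n`. -/
def codimPart (X : SubalgebraClass k L) (n : ℕ) : SubalgebraClass k L :=
  fun K _ _ _ => {H | H ∈ X K ∧ Module.rank K ((K ⊗[k] L) ⧸ H.toSubmodule) = n}

/-- `A_n(X)` for a `ℤ`-filtration `F`: the members `H` of `X` of codimension `n` in `F 0`, which
is the sum of the codimensions of `H ∩ F 0` in `H` and in `F 0`. -/
def relCodimPart (F : ℤ → Submodule k L) (X : SubalgebraClass k L) (n : ℕ) :
    SubalgebraClass k L :=
  fun K _ _ _ => {H | H ∈ X K ∧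
    Module.rank K (H.toSubmodule ⧸ ((F 0).baseChange K).submoduleOf H.toSubmodule) +
      Module.rank K ((F 0).baseChange K ⧸ H.toSubmodule.submoduleOf ((F 0).baseChange K)) = n}

/-- The members `H` of `X` with `A ⊗ K ⊆ H ⊆ B ⊗ K`. -/
def between (A B : Submodule k L) (X : SubalgebraClass k L) : SubalgebraClass k L :=
  fun K _ _ _ => {H | H ∈ X K ∧ A.baseChange K ≤ H.toSubmodule ∧ H.toSubmodule ≤ B.baseChange K}

/-- The set of points of the Grassmannian of `B / A` given by the members of `X` between `A`
and `B`. -/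
def grassmannianPoints (A B : Submodule k L) (X : SubalgebraClass k L) :
    SubspaceFamily k (B ⧸ A.submoduleOf B) :=
  fun K _ _ _ => {W | ∃ H ∈ between A B X K, subquotientPoint A B K H.toSubmodule = W}

/-- `X` is a stable class of subalgebras of the `ℕ`-filtered Lie algebra `L`. With
`A_{l,n}` the set of members of `X` of codimension `n` that contain `F l`: every `A_{l,n}` is a
constructible subset of the Grassmannian of `L / F l` (that is, `X` is a constructible class), and
for every `n` the sets `A_{l,n}` do not depend on `l` for large `l`. -/
def IsStableClass (F : ℕ → Submodule k L) (X : SubalgebraClass k L) : Prop :=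
  (∀ l n : ℕ, IsConstructibleFamily (grassmannianPoints (F l) ⊤ (codimPart X n))) ∧
  ∀ n : ℕ, ∃ l : ℕ, ∀ j ≥ l, ∀ (K : Type u) [Field K] [Algebra k K] [FiniteDimensional k K],
    between (F j) ⊤ (codimPart X n) K = between (F l) ⊤ (codimPart X n) K

/-- `X` is a stable class of subalgebras of the `ℤ`-filtered Lie algebra `L`. Now codimensions
are relative to `F 0`, and `A_{l,n}`, the set of members `H` of `X` of codimension `n` with
`F l ⊆ H ⊆ F (-l)`, is considered as a subset of the Grassmannian of `F (-l) / F l`. -/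
def IsStableClassZ (F : ℤ → Submodule k L) (X : SubalgebraClass k L) : Prop :=
  (∀ l n : ℕ, IsConstructibleFamily (grassmannianPoints (F l) (F (-l)) (relCodimPart F X n))) ∧
  ∀ n : ℕ, ∃ l : ℕ, ∀ j : ℕ, l ≤ j →
    ∀ (K : Type u) [Field K] [Algebra k K] [FiniteDimensional k K],
      between (F j) (F (-j)) (relCodimPart F X n) K = between (F l) (F (-l)) (relCodimPart F X n) K

end Classes

end

/-!
Let `N = 2 n m`, where `m` is the maximum of the `mᵢ`.

*Containment of `L_N`.* Let `H` be a closed subalgebra of `L₀ ⊗ K` of codimension `n`, and call a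
degree `r` exceptional if `H` does not contain all leading terms of degree `r`. There are at most
`n` exceptional degrees (`card_le_of_antitone`). Since `𝔤ᵢ = [𝔤ᵢ, 𝔤ᵢ]`, comparing eigencomponents
gives `𝔤ᵢ,ᵣ = ∑ₐ [𝔤ᵢ,ₐ, 𝔤ᵢ,ᵣ₋ₐ]` with `a` running through the residues modulo `mᵢ`
(`mem_span_lie_twistEigenspace`). If `r ≥ N` were exceptional, each residue class would contain
at least `2 n - 1` candidates `a` with `1 ≤ a ≤ r - 1`, while the other exceptional degrees, at
most `n - 1`, rule out at most two candidates each (`exists_add_eq_notMem`). So leading terms of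
`H` in non-exceptional degrees produce all leading terms of degree `r`, a contradiction. Hence no
degree `≥ N` is exceptional and, `H` being closed, `L_N ⊗ K ⊆ H` (`filtration_le_of_rank_le`). The
argument never meets `cᵢ` and `dᵢ`, which have degree `0`. For `H ⊆ L ⊗ K` it applies to the
intersection with `L₀ ⊗ K`.

*Boundedness below.* Let `H ⊆ L ⊗ K` have codimension `n` relative to `L₀ ⊗ K`, and let `z ∈ H`
have leading degree `d` below `-(N + (n + 1) m)`. The centre of `𝔤ᵢ ⊗ K` is trivial, so some
leading coefficient of `z` has a non-zero bracket with an eigenvector `y` of `σᵢ`, and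
`y t ^ b ∈ L_N ⊆ H` for all `b ≥ N` in a residue class modulo `mᵢ`. The brackets `[z, y t ^ b] ∈ H`
have leading degrees `d + b`, of which more than `n` are negative; this is too many modulo
`L₀ ⊗ K` (`le_filtration_of_rank_le`).

These two bounds show that the sets `A_{l,n}` are independent of `l` for large `l`.

*Constructibility.* On a chart of the Grassmannian of `B / A` the subspace `H` has generators with
polynomial coefficients (`chartGenerators`), and it is cut out by linear equations with polynomial
coefficients (`mem_liftPoint_chart_iff`). To be a subalgebra or an ideal is therefore a system of
polynomial equations, infinite in number, but the polynomial ring is noetherian. Both relative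
codimensions are ranks of families of vectors with polynomial coefficients, so they are
constructible functions by the minor criterion (`isConstructibleCondition_rank_eq`). The
remaining conditions, closedness and commensurability, hold automatically.
-/

/-! ### Constructible conditions on the coordinates of a point -/

section Constructible

variable {k : Type u} [Field k] {τ : Type}

/-- A condition on points of the affine space `𝔸^τ` with coordinates in finite extensions of `k`
is constructible if it holds exactly at the points of a constructible set of the spectrum of the
polynomial ring over `k`. -/
def IsConstructibleCondition
    (P : ∀ (K : Type u) [Field K] [Algebra k K] [FiniteDimensional k K], (τ → K) → Prop) : Prop :=
  ∃ Z : Set (PrimeSpectrum (MvPolynomial τ k)), Topology.IsConstructible Z ∧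
    ∀ (K : Type u) [Field K] [Algebra k K] [FiniteDimensional k K] (x : τ → K),
      P K x ↔ affinePoint x ∈ Z

theorem mem_affinePoint {K : Type u} [Field K] [Algebra k K] (x : τ → K) (f : MvPolynomial τ k) :
    f ∈ (affinePoint x).asIdeal ↔ MvPolynomial.aeval x f = 0 := by
  simp [affinePoint]

namespace IsConstructibleCondition

variable {P Q : ∀ (K : Type u) [Field K] [Algebra k K] [FiniteDimensional k K], (τ → K) → Prop}

theorem congr (hP : IsConstructibleCondition P)
    (h : ∀ (K : Type u) [Field K] [Algebra k K] [FiniteDimensional k K] (x : τ → K),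
      Q K x ↔ P K x) : IsConstructibleCondition Q := by
  obtain ⟨Z, hZ, h'⟩ := hP
  exact ⟨Z, hZ, fun K _ _ _ x => (h K x).trans (h' K x)⟩

theorem and (hP : IsConstructibleCondition P) (hQ : IsConstructibleCondition Q) :
    IsConstructibleCondition (k := k) (τ := τ) fun K _ _ _ x => P K x ∧ Q K x := by
  obtain ⟨Z, hZ, h⟩ := hP
  obtain ⟨Z', hZ', h'⟩ := hQ
  exact ⟨Z ∩ Z', hZ.inter hZ', fun K _ _ _ x => and_congr (h K x) (h' K x)⟩

theorem not (hP : IsConstructibleCondition P) :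
    IsConstructibleCondition (k := k) (τ := τ) fun K _ _ _ x => ¬ P K x := by
  obtain ⟨Z, hZ, h⟩ := hP
  exact ⟨Zᶜ, hZ.compl, fun K _ _ _ x => not_congr (h K x)⟩

theorem const (p : Prop) :
    IsConstructibleCondition (k := k) (τ := τ) fun _ _ _ _ _ => p := by
  by_cases hp : p
  · exact ⟨Set.univ, .univ, fun K _ _ _ x => by simp [hp]⟩
  · exact ⟨∅, .empty, fun K _ _ _ x => by simp [hp]⟩

theorem exists_of_finite {α : Type*} [Finite α]
    {P : α → ∀ (K : Type u) [Field K] [Algebra k K] [FiniteDimensional k K], (τ → K) → Prop}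
    (hP : ∀ a, IsConstructibleCondition (P a)) :
    IsConstructibleCondition (k := k) (τ := τ) fun K _ _ _ x => ∃ a, P a K x := by
  choose Z hZ h using hP
  exact ⟨⋃ a, Z a, .iUnion hZ, fun K _ _ _ x => by simp [← h]⟩

end IsConstructibleCondition

theorem isConstructible_of_isOpen [Finite τ] {Z : Set (PrimeSpectrum (MvPolynomial τ k))}
    (hZ : IsOpen Z) :
    Topology.IsConstructible Z :=
  (TopologicalSpace.NoetherianSpace.isCompact Z).isConstructible hZ

/-- The non-vanishing of some member of a family of polynomials is an open condition, hence a
constructible one: the spectrum of a polynomial ring in finitely many variables is noetherian. -/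
theorem isConstructibleCondition_exists_ne_zero [Finite τ] {α : Type*} (f : α → MvPolynomial τ k) :
    IsConstructibleCondition (k := k) fun K _ _ _ (x : τ → K) =>
      ∃ a, MvPolynomial.aeval x (f a) ≠ 0 := by
  refine ⟨⋃ a, PrimeSpectrum.basicOpen (f a), isConstructible_of_isOpen
    (isOpen_iUnion fun a => (PrimeSpectrum.basicOpen (f a)).isOpen), fun K _ _ _ x => ?_⟩
  simp [mem_affinePoint]

end Constructible

/-! ### Specialization of polynomial families of vectors -/

section Specialize

variable {k : Type u} [Field k] {τ : Type} {K : Type u} [Field K] [Algebra k K]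
  {V : Type*} [AddCommGroup V] [Module k V] {W : Type*} [AddCommGroup W] [Module k W]

/-- The value at a point `x` with coordinates in `K` of a vector with polynomial coefficients. -/
noncomputable def specialize (x : τ → K) : MvPolynomial τ k ⊗[k] V →ₗ[k] K ⊗[k] V :=
  (MvPolynomial.aeval x).toLinearMap.rTensor V

@[simp] theorem specialize_tmul (x : τ → K) (f : MvPolynomial τ k) (v : V) :
    specialize x (f ⊗ₜ v) = MvPolynomial.aeval x f ⊗ₜ[k] v := rfl

theorem specialize_smul (x : τ → K) (f : MvPolynomial τ k) (z : MvPolynomial τ k ⊗[k] V) :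
    specialize x (f • z) = MvPolynomial.aeval x f • specialize x z := by
  induction z using TensorProduct.induction_on with
  | zero => simp
  | tmul g v => simp [TensorProduct.smul_tmul']
  | add z z' h h' => simp [h, h']

theorem rTensor_lie {L R S : Type*} [LieRing L] [LieAlgebra k L] [CommRing R] [Algebra k R]
    [CommRing S] [Algebra k S] (φ : R →ₐ[k] S) (z z' : R ⊗[k] L) :
    φ.toLinearMap.rTensor L ⁅z, z'⁆ = ⁅φ.toLinearMap.rTensor L z, φ.toLinearMap.rTensor L z'⁆ := by
  induction z using TensorProduct.induction_on with
  | zero => simp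
  | add z₁ z₂ h h' => simp [h, h']
  | tmul g v =>
    induction z' using TensorProduct.induction_on with
    | zero => simp
    | add z₁ z₂ h h' => simp only [lie_add, map_add, h, h']
    | tmul g' v' => simp

theorem specialize_lie {L : Type*} [LieRing L] [LieAlgebra k L] (x : τ → K)
    (z z' : MvPolynomial τ k ⊗[k] L) :
    specialize x ⁅z, z'⁆ = ⁅specialize x z, specialize x z'⁆ :=
  rTensor_lie _ z z'

theorem specialize_baseChange (x : τ → K) (f : V →ₗ[k] W) (z : MvPolynomial τ k ⊗[k] V) :
    specialize x (f.baseChange (MvPolynomial τ k) z) = f.baseChange K (specialize x z) := by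
  induction z using TensorProduct.induction_on with
  | zero => simp
  | tmul g v => simp
  | add z z' h h' => simp [h, h']

theorem repr_specialize {α : Type*} (b : Module.Basis α k V) (x : τ → K)
    (z : MvPolynomial τ k ⊗[k] V) (a : α) :
    (b.baseChange K).repr (specialize x z) a =
      MvPolynomial.aeval x ((b.baseChange (MvPolynomial τ k)).repr z a) := by
  induction z using TensorProduct.induction_on with
  | zero => simp
  | tmul g v => simp
  | add z z' h h' => simp [h, h']

theorem isConstructibleCondition_specialize_eq_zero [Finite τ] {α : Type*}
    (U : α → MvPolynomial τ k ⊗[k] V) :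
    IsConstructibleCondition (k := k) fun K _ _ _ (x : τ → K) => ∀ a, specialize x (U a) = 0 := by
  let b := Module.Basis.ofVectorSpace k V
  refine (isConstructibleCondition_exists_ne_zero fun a : α × _ =>
    (b.baseChange (MvPolynomial τ k)).repr (U a.1) a.2).not.congr fun K _ _ _ x => ?_
  simp only [← repr_specialize, not_exists, not_not, Prod.forall]
  refine forall_congr' fun a => ?_
  rw [← (b.baseChange K).repr.map_eq_zero_iff, Finsupp.ext_iff]
  rfl

/-- Finitely many linearly independent coordinate vectors have a non-zero minor of full size. -/
theorem linearIndependent_iff_exists_det_ne_zero {α : Type*} {r : ℕ} (v : Fin r → α →₀ K) :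
    LinearIndependent K v ↔
      ∃ c : Fin r → α, (Matrix.of fun i j => v i (c j)).det ≠ 0 := by
  constructor
  · intro hv
    let w : α → Fin r → K := fun a i => v i a
    -- a functional vanishing on all columns `w a` is a linear relation between the rows `v i`
    have hspan : Submodule.span K (Set.range w) = ⊤ := by
      by_contra hne
      obtain ⟨f, hf, hf'⟩ := Submodule.exists_le_ker_of_lt_top _ (lt_top_iff_ne_top.2 hne)
      have h0 : ∑ i, f (Pi.single i 1) • v i = 0 := by
        refine Finsupp.ext fun a => ?_
        rw [Finsupp.zero_apply]
        have h1 : f (w a) = 0 := hf' (Submodule.subset_span ⟨a, rfl⟩)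
        rw [← h1]
        conv_rhs => rw [pi_eq_sum_univ' (w a), map_sum]
        simp only [Finsupp.coe_finsetSum, Finset.sum_apply, map_smul, Finsupp.smul_apply,
          smul_eq_mul]
        refine Finset.sum_congr rfl fun i _ => ?_
        rw [mul_comm]
      have h2 := Fintype.linearIndependent_iff.1 hv _ h0
      refine hf (LinearMap.pi_ext' fun i => LinearMap.ext_ring ?_)
      simpa using h2 i
    obtain ⟨s, hs, hs', hli⟩ := exists_linearIndependent K (Set.range w)
    rw [hspan] at hs'
    have e : Module.Basis s K (Fin r → K) := Module.Basis.mk hli (by simp [hs'])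
    have : Fintype s := Module.Basis.fintypeIndexOfRankLtAleph0 e (Module.rank_lt_aleph0 _ _)
    have hcard : Fintype.card s = r := by
      rw [← Module.finrank_eq_card_basis e]; simp
    let g : Fin r ≃ s := (Fintype.equivFinOfCardEq hcard).symm
    choose c hc using fun j => hs (g j).2
    refine ⟨c, ?_⟩
    have hli' : LinearIndependent K fun j => w (c j) := by
      simp only [hc]
      exact hli.comp g g.injective
    have := (Matrix.linearIndependent_rows_iff_isUnit (A := Matrix.of fun i j => v j (c i))).1 hli'
    rw [Matrix.isUnit_iff_isUnit_det, ← Matrix.det_transpose] at this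
    exact this.ne_zero
  · rintro ⟨c, hc⟩
    have h := (Matrix.linearIndependent_rows_iff_isUnit (A := Matrix.of fun i j => v i (c j))).2
      ((Matrix.isUnit_iff_isUnit_det _).2 hc.isUnit)
    exact LinearIndependent.of_comp (LinearMap.pi fun j => Finsupp.lapply (c j)) h

theorem natCast_le_rank_span_iff {M : Type*} [AddCommGroup M] [Module K M] {α : Type*} (v : α → M)
    (r : ℕ) : (r : Cardinal) ≤ Module.rank K (Submodule.span K (Set.range v)) ↔
      ∃ s : Fin r → α, LinearIndependent K (v ∘ s) := by
  constructor
  · intro h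
    obtain ⟨t, ht, ht', hli⟩ := exists_linearIndependent K (Set.range v)
    rw [← ht', rank_span_set hli] at h
    obtain ⟨t', ht'', hc⟩ := Cardinal.le_mk_iff_exists_subset.1 h
    have hf : Finite t' := Cardinal.mk_lt_aleph0_iff.1 (hc ▸ Cardinal.natCast_lt_aleph0)
    have := Fintype.ofFinite t'
    rw [Cardinal.mk_fintype, Nat.cast_inj] at hc
    let g : Fin r ≃ t' := (Fintype.equivFinOfCardEq hc).symm
    choose s hs using fun j => ht (ht'' (g j).2)
    refine ⟨s, ?_⟩
    have h2 : v ∘ s = (fun y : t => (y : M)) ∘ (fun j => ⟨g j, ht'' (g j).2⟩) := by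
      ext j; exact hs j
    rw [h2]
    exact hli.comp _ fun i j hij => g.injective (Subtype.ext (by simpa using hij))
  · rintro ⟨s, hs⟩
    have h2 : Submodule.span K (Set.range (v ∘ s)) ≤ Submodule.span K (Set.range v) :=
      Submodule.span_mono (Set.range_comp_subset_range s v)
    have h3 := Submodule.rank_mono h2
    refine le_trans (le_of_eq ?_) h3
    have := Module.Finite.span_of_finite K (Set.finite_range (v ∘ s))
    rw [← Module.finrank_eq_rank, finrank_span_eq_card hs, Fintype.card_fin]

/-- The rank of a family of vectors depending polynomially on a point is a constructible function
of the point: it is at least `r` if and only if some minor of size `r` does not vanish. -/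
theorem isConstructibleCondition_rank_eq [Finite τ] {α : Type*}
    (U : α → MvPolynomial τ k ⊗[k] V) (r : ℕ) :
    IsConstructibleCondition (k := k) fun K _ _ _ (x : τ → K) =>
      Module.rank K (Submodule.span K (Set.range fun a => specialize x (U a))) = r := by
  let b := Module.Basis.ofVectorSpace k V
  have key (r : ℕ) : IsConstructibleCondition (k := k) fun K _ _ _ (x : τ → K) =>
      r ≤ Module.rank K (Submodule.span K (Set.range fun a => specialize x (U a))) := by
    refine (isConstructibleCondition_exists_ne_zero fun sc : (Fin r → α) × (Fin r → _) =>
      (Matrix.of fun i j => (b.baseChange (MvPolynomial τ k)).repr (U (sc.1 i)) (sc.2 j)).det).congr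
        fun K _ _ _ x => ?_
    rw [natCast_le_rank_span_iff, Prod.exists]
    refine exists_congr fun s => ?_
    rw [← LinearMap.linearIndependent_iff_of_injOn (b.baseChange K).repr.toLinearMap
      (b.baseChange K).repr.injective.injOn, linearIndependent_iff_exists_det_ne_zero]
    refine exists_congr fun c => ?_
    rw [AlgHom.map_det]
    simp only [Function.comp_apply, LinearEquiv.coe_coe, repr_specialize]
    rfl
  refine ((key r).and (key (r + 1)).not).congr fun K _ _ _ x => ?_
  rw [not_le, Nat.cast_add_one, ← Cardinal.succ_natCast, Order.lt_succ_iff, eq_comm,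
    le_antisymm_iff]

end Specialize

/-! ### Points of the Grassmannian of a subquotient -/

section BaseChange

variable {k : Type u} [Field k] (K : Type u) [Field K] [Algebra k K]
  {V : Type*} [AddCommGroup V] [Module k V] {W : Type*} [AddCommGroup W] [Module k W]

theorem ker_baseChange (f : V →ₗ[k] W) :
    LinearMap.ker (f.baseChange K) = (LinearMap.ker f).baseChange K := by
  have h := Module.Flat.lTensor_exact K (LinearMap.exact_subtype_ker_map f)
  ext z
  exact h z

theorem mem_baseChange_iff_mkQ (B : Submodule k V) (z : K ⊗[k] V) :
    z ∈ B.baseChange K ↔ B.mkQ.baseChange K z = 0 := by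
  rw [← LinearMap.mem_ker, ker_baseChange, Submodule.ker_mkQ]

theorem baseChange_subtype_injective (B : Submodule k V) :
    Function.Injective (B.subtype.baseChange K) :=
  Module.Flat.lTensor_preserves_injective_linearMap _ B.subtype_injective

theorem span_range_one_tmul : Submodule.span K (Set.range fun v : V => (1 : K) ⊗ₜ[k] v) = ⊤ := by
  have h := Submodule.baseChange_eq_span (R := k) (M := V) K ⊤
  rw [Submodule.baseChange_top] at h
  rw [h]
  congr 1
  ext z
  simp

end BaseChange

section Subquotient

variable {k : Type u} [Field k] {L : Type v} [LieRing L] [LieAlgebra k L] (A B : Submodule k L)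

/-- The inverse of `subquotientPoint`: the subspace of `L ⊗ K` between `A ⊗ K` and `B ⊗ K` defined
by a subspace of `(B / A) ⊗ K`. -/
def liftPoint (K : Type u) [Field K] [Algebra k K]
    (W : Submodule K (K ⊗[k] (B ⧸ A.submoduleOf B))) : Submodule K (K ⊗[k] L) :=
  (W.comap ((A.submoduleOf B).mkQ.baseChange K)).map (B.subtype.baseChange K)

variable {A B} {K : Type u} [Field K] [Algebra k K]

theorem baseChange_eq_map_submoduleOf (hAB : A ≤ B) :
    A.baseChange K = ((A.submoduleOf B).baseChange K).map (B.subtype.baseChange K) := by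
  rw [Submodule.baseChange_eq_span, Submodule.baseChange_eq_span, Submodule.map_span]
  congr 1
  ext z
  simp only [Submodule.map_coe, Set.mem_image, SetLike.mem_coe, TensorProduct.mk_apply]
  constructor
  · rintro ⟨a, ha, rfl⟩
    exact ⟨_, ⟨⟨a, hAB ha⟩, ha, rfl⟩, rfl⟩
  · rintro ⟨_, ⟨a, ha, rfl⟩, rfl⟩
    exact ⟨a, ha, rfl⟩

theorem baseChange_le_liftPoint (hAB : A ≤ B) (W : Submodule K (K ⊗[k] (B ⧸ A.submoduleOf B))) :
    A.baseChange K ≤ liftPoint A B K W := by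
  rw [baseChange_eq_map_submoduleOf hAB]
  refine Submodule.map_mono fun z hz => ?_
  rw [mem_baseChange_iff_mkQ] at hz
  rw [Submodule.mem_comap, hz]
  exact zero_mem _

theorem liftPoint_le (W : Submodule K (K ⊗[k] (B ⧸ A.submoduleOf B))) :
    liftPoint A B K W ≤ B.baseChange K :=
  LinearMap.map_le_range

theorem subquotientPoint_liftPoint (W : Submodule K (K ⊗[k] (B ⧸ A.submoduleOf B))) :
    subquotientPoint A B K (liftPoint A B K W) = W := by
  rw [subquotientPoint, liftPoint,
    Submodule.comap_map_eq_of_injective (baseChange_subtype_injective K B),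
    Submodule.map_comap_eq_of_surjective
      (LinearMap.baseChange_surjective K (Submodule.mkQ_surjective _))]

theorem liftPoint_subquotientPoint (hAB : A ≤ B) {H : Submodule K (K ⊗[k] L)}
    (hA : A.baseChange K ≤ H) (hB : H ≤ B.baseChange K) :
    liftPoint A B K (subquotientPoint A B K H) = H := by
  rw [subquotientPoint, liftPoint, Submodule.comap_map_eq, ker_baseChange, Submodule.ker_mkQ,
    Submodule.map_sup, ← baseChange_eq_map_submoduleOf hAB, Submodule.map_comap_eq]
  rw [show (B.subtype.baseChange K).range = B.baseChange K from rfl, inf_eq_right.2 hB,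
    sup_eq_left.2 hA]

theorem mem_grassmannianPoints_iff [FiniteDimensional k K] (hAB : A ≤ B) (X : SubalgebraClass k L)
    (W : Submodule K (K ⊗[k] (B ⧸ A.submoduleOf B))) :
    W ∈ grassmannianPoints A B X K ↔ ∃ H ∈ X K, H.toSubmodule = liftPoint A B K W := by
  constructor
  · rintro ⟨H, ⟨hX, hA, hB⟩, rfl⟩
    exact ⟨H, hX, (liftPoint_subquotientPoint hAB hA hB).symm⟩
  · rintro ⟨H, hX, hH⟩
    exact ⟨H, ⟨hX, hH ▸ baseChange_le_liftPoint hAB W, hH ▸ liftPoint_le W⟩,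
      by rw [hH, subquotientPoint_liftPoint]⟩

end Subquotient

/-! ### Equations and generators for the points of a chart -/

section Chart

variable {k : Type u} [Field k] {V : Type*} [AddCommGroup V] [Module k V] {p q : ℕ}
  (b : Module.Basis (Fin p ⊕ Fin q) k V)

theorem basis_induction_on {R M α : Type*} [CommRing R] [AddCommGroup M] [Module R M]
    (b : Module.Basis α R M) {P : M → Prop} (z : M) (zero : P 0)
    (add : ∀ z z', P z → P z' → P (z + z')) (smul : ∀ (c : R) z, P z → P (c • z))
    (basis : ∀ a, P (b a)) : P z := by
  have hz := b.mem_span z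
  induction hz using Submodule.span_induction with
  | zero => exact zero
  | add z z' _ _ h h' => exact add z z' h h'
  | smul c z _ h => exact smul c z h
  | mem z hz =>
    obtain ⟨a, rfl⟩ := hz
    exact basis a

/-- The linear map whose kernel is the point `x` of the chart: `vⱼ - ∑ᵢ uᵢ xᵢⱼ` in the coordinates
`(u, v)` given by the basis `b`. -/
noncomputable def chartEquations {S : Type*} [CommRing S] [Algebra k S] (x : Fin p × Fin q → S) :
    S ⊗[k] V →ₗ[S] S ⊗[k] (Fin q → k) :=
  (b.baseChange S).constr S (Sum.elim
    (fun i => -∑ j, x (i, j) ⊗ₜ[k] Pi.single j 1) (fun j => 1 ⊗ₜ[k] Pi.single j 1))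

section

variable {S : Type*} [CommRing S] [Algebra k S] (x : Fin p × Fin q → S)

@[simp] theorem chartEquations_inl (i : Fin p) :
    chartEquations b x (1 ⊗ₜ b (Sum.inl i)) = -∑ j, x (i, j) ⊗ₜ[k] Pi.single j 1 := by
  rw [← Module.Basis.baseChange_apply, chartEquations, Module.Basis.constr_basis, Sum.elim_inl]

@[simp] theorem chartEquations_inr (j : Fin q) :
    chartEquations b x (1 ⊗ₜ b (Sum.inr j)) = 1 ⊗ₜ[k] Pi.single j 1 := by
  rw [← Module.Basis.baseChange_apply, chartEquations, Module.Basis.constr_basis, Sum.elim_inr]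

theorem chartEquations_tmul_inr (s : S) (j : Fin q) :
    chartEquations b x (s ⊗ₜ b (Sum.inr j)) = s ⊗ₜ[k] Pi.single j 1 := by
  rw [← mul_one s, ← smul_eq_mul, ← TensorProduct.smul_tmul', map_smul, chartEquations_inr,
    TensorProduct.smul_tmul']

end

variable {K : Type u} [Field K] [Algebra k K] (x : Fin p × Fin q → K)

theorem specialize_chartEquations (z : MvPolynomial (Fin p × Fin q) k ⊗[k] V) :
    specialize x (chartEquations b MvPolynomial.X z) = chartEquations b x (specialize x z) := by
  induction z using basis_induction_on (b.baseChange (MvPolynomial (Fin p × Fin q) k)) with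
  | zero => simp
  | add z z' h h' => simp only [map_add, h, h']
  | smul c z h => simp only [map_smul, specialize_smul, h]
  | basis i =>
    rw [Module.Basis.baseChange_apply]
    rcases i with i | j
    · rw [chartEquations_inl, specialize_tmul, map_one, chartEquations_inl]
      simp
    · rw [chartEquations_inr, specialize_tmul, map_one, specialize_tmul, map_one,
        chartEquations_inr]

theorem ker_chartEquations :
    LinearMap.ker (chartEquations b x) = grassmannianChart b K x := by
  apply le_antisymm
  · -- `z` differs from a vector of the chart point by an image of `chartEquations b x z`
    let T : (Fin q → k) →ₗ[k] V := Fintype.linearCombination k fun j => b (Sum.inr j)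
    have hT (s : K) (j : Fin q) : T.baseChange K (s ⊗ₜ Pi.single j 1) = s ⊗ₜ b (Sum.inr j) := by
      simp [T, Fintype.linearCombination_apply_single]
    have key (z : K ⊗[k] V) :
        z - T.baseChange K (chartEquations b x z) ∈ grassmannianChart b K x := by
      induction z using basis_induction_on (b.baseChange K) with
      | zero => simp
      | add z z' h h' =>
        have := add_mem h h'
        rw [map_add, map_add]
        convert this using 1
        abel
      | smul c z h =>
        rw [map_smul, map_smul, ← smul_sub]
        exact Submodule.smul_mem _ c h
      | basis i =>
        rw [Module.Basis.baseChange_apply]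
        rcases i with i | j
        · rw [chartEquations_inl, map_neg, map_sum, sub_neg_eq_add]
          simp only [hT]
          exact Submodule.subset_span ⟨i, rfl⟩
        · rw [chartEquations_inr, hT, sub_self]
          exact zero_mem _
    intro z hz
    have := key z
    rwa [LinearMap.mem_ker.1 hz, map_zero, sub_zero] at this
  · rw [grassmannianChart, Submodule.span_le]
    rintro _ ⟨i, rfl⟩
    simp [chartEquations_tmul_inr]

theorem chartEquations_surjective : Function.Surjective (chartEquations b x) := by
  rw [← LinearMap.range_eq_top, eq_top_iff, ← ((Pi.basisFun k (Fin q)).baseChange K).span_eq,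
    Submodule.span_le]
  rintro _ ⟨j, rfl⟩
  refine ⟨1 ⊗ₜ b (Sum.inr j), ?_⟩
  rw [chartEquations_inr, Module.Basis.baseChange_apply, Pi.basisFun_apply]

end Chart

section ChartPoint

variable {k : Type u} [Field k] {L : Type v} [LieRing L] [LieAlgebra k L] {A B : Submodule k L}
  {p q : ℕ} (b : Module.Basis (Fin p ⊕ Fin q) k (B ⧸ A.submoduleOf B))

variable (B) in
/-- A linear projection of the ambient space onto a subspace. -/
noncomputable def projOnto : L →ₗ[k] B :=
  (LinearMap.exists_leftInverse_of_injective B.subtype B.ker_subtype).choose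

theorem projOnto_comp_subtype : projOnto B ∘ₗ B.subtype = LinearMap.id :=
  (LinearMap.exists_leftInverse_of_injective B.subtype B.ker_subtype).choose_spec

variable (A B) in
/-- A linear extension to the whole space of the quotient map `B → B / A`. -/
noncomputable def projQuot : L →ₗ[k] B ⧸ A.submoduleOf B := (A.submoduleOf B).mkQ ∘ₗ projOnto B

theorem projQuot_comp_subtype : projQuot A B ∘ₗ B.subtype = (A.submoduleOf B).mkQ := by
  rw [projQuot, LinearMap.comp_assoc, projOnto_comp_subtype, LinearMap.comp_id]

/-- A representative in `B` of an element of `B / A`. -/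
noncomputable def quotRep (w : B ⧸ A.submoduleOf B) : B := (Submodule.mkQ_surjective _ w).choose

theorem mkQ_quotRep (w : B ⧸ A.submoduleOf B) : (A.submoduleOf B).mkQ (quotRep w) = w :=
  (Submodule.mkQ_surjective _ w).choose_spec

theorem projQuot_baseChange_subtype (K : Type u) [Field K] [Algebra k K] (z : K ⊗[k] B) :
    (projQuot A B).baseChange K (B.subtype.baseChange K z) =
      (A.submoduleOf B).mkQ.baseChange K z := by
  rw [← projQuot_comp_subtype, LinearMap.baseChange_comp, LinearMap.comp_apply]

/-- Generators, with polynomial coefficients, of the subspaces of `L ⊗ K` which correspond to the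
points of a chart. -/
noncomputable def chartGenerators : A ⊕ Fin p → MvPolynomial (Fin p × Fin q) k ⊗[k] L :=
  Sum.elim (fun a => 1 ⊗ₜ (a : L)) fun i => 1 ⊗ₜ (quotRep (b (Sum.inl i)) : L) +
    ∑ j, MvPolynomial.X (i, j) ⊗ₜ[k] (quotRep (b (Sum.inr j)) : L)

variable {K : Type u} [Field K] [Algebra k K] (x : Fin p × Fin q → K)

theorem mem_liftPoint_chart_iff (z : K ⊗[k] L) :
    z ∈ liftPoint A B K (grassmannianChart b K x) ↔
      B.mkQ.baseChange K z = 0 ∧ chartEquations b x ((projQuot A B).baseChange K z) = 0 := by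
  rw [← mem_baseChange_iff_mkQ, liftPoint, ← ker_chartEquations]
  constructor
  · rintro ⟨z, hz, rfl⟩
    refine ⟨⟨z, rfl⟩, ?_⟩
    rw [projQuot_baseChange_subtype]
    exact hz
  · rintro ⟨⟨z, rfl⟩, hz⟩
    rw [projQuot_baseChange_subtype] at hz
    exact ⟨z, hz, rfl⟩

/-- The specialized generators span: their images span the point of the chart, and they include the
kernel of `B ⊗ K → (B / A) ⊗ K`. -/
theorem liftPoint_chart_eq_span (hAB : A ≤ B) :
    liftPoint A B K (grassmannianChart b K x) =
      Submodule.span K (Set.range fun a => specialize x (chartGenerators b a)) := by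
  let g : Fin p → K ⊗[k] B := fun i => 1 ⊗ₜ quotRep (b (Sum.inl i)) +
    ∑ j, x (i, j) ⊗ₜ[k] quotRep (b (Sum.inr j))
  have hg : grassmannianChart b K x =
      (Submodule.span K (Set.range g)).map ((A.submoduleOf B).mkQ.baseChange K) := by
    rw [Submodule.map_span, ← Set.range_comp, grassmannianChart]
    congr 2
    ext1 i
    simp only [g, Function.comp_apply, map_add, map_sum, LinearMap.baseChange_tmul, mkQ_quotRep]
  rw [liftPoint, hg, Submodule.comap_map_eq, ker_baseChange, Submodule.ker_mkQ,
    Submodule.map_sup, ← baseChange_eq_map_submoduleOf hAB, Submodule.map_span, ← Set.range_comp,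
    Submodule.baseChange_eq_span, ← Submodule.span_union, Set.union_comm]
  congr 1
  ext z
  simp [chartGenerators, g]

/-- The closure of the subspaces under brackets with two polynomial families of vectors is cut out
by polynomial equations. -/
theorem isConstructibleCondition_lie_mem {α β : Type*}
    (U : α → MvPolynomial (Fin p × Fin q) k ⊗[k] L)
    (U' : β → MvPolynomial (Fin p × Fin q) k ⊗[k] L) :
    IsConstructibleCondition (k := k) fun K _ _ _ (x : Fin p × Fin q → K) =>
      ∀ u ∈ Submodule.span K (Set.range fun a => specialize x (U a)),
      ∀ v ∈ Submodule.span K (Set.range fun a => specialize x (U' a)),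
        ⁅u, v⁆ ∈ liftPoint A B K (grassmannianChart b K x) := by
  refine ((isConstructibleCondition_specialize_eq_zero fun c : α × β =>
      B.mkQ.baseChange (MvPolynomial (Fin p × Fin q) k) ⁅U c.1, U' c.2⁆).and
    (isConstructibleCondition_specialize_eq_zero fun c : α × β =>
      chartEquations b MvPolynomial.X ((projQuot A B).baseChange
        (MvPolynomial (Fin p × Fin q) k) ⁅U c.1, U' c.2⁆))).congr fun K _ _ _ x => ?_
  simp only [specialize_chartEquations, specialize_baseChange, specialize_lie, ← forall_and,
    ← mem_liftPoint_chart_iff, Prod.forall]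
  constructor
  · exact fun h a a' => h _ (Submodule.subset_span ⟨a, rfl⟩) _ (Submodule.subset_span ⟨a', rfl⟩)
  · intro h u hu v hv
    induction hu using Submodule.span_induction with
    | zero => rw [zero_lie]; exact zero_mem _
    | add u u' _ _ h h' => rw [add_lie]; exact add_mem h h'
    | smul c u _ h => rw [smul_lie]; exact Submodule.smul_mem _ c h
    | mem u hu =>
      obtain ⟨a, rfl⟩ := hu
      induction hv using Submodule.span_induction with
      | zero => rw [lie_zero]; exact zero_mem _
      | add u u' _ _ h h' => rw [lie_add]; exact add_mem h h'
      | smul c u _ h => rw [lie_smul]; exact Submodule.smul_mem _ c h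
      | mem v hv =>
        obtain ⟨a', rfl⟩ := hv
        exact h a a'

theorem isConstructibleCondition_subalgebra (hAB : A ≤ B) :
    IsConstructibleCondition (k := k) fun K _ _ _ (x : Fin p × Fin q → K) =>
      ∀ u ∈ liftPoint A B K (grassmannianChart b K x),
      ∀ v ∈ liftPoint A B K (grassmannianChart b K x),
        ⁅u, v⁆ ∈ liftPoint A B K (grassmannianChart b K x) :=
  (isConstructibleCondition_lie_mem b (chartGenerators b) (chartGenerators b)).congr
    fun K _ _ _ x => by rw [← liftPoint_chart_eq_span b x hAB]

theorem isConstructibleCondition_ideal (hAB : A ≤ B) :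
    IsConstructibleCondition (k := k) fun K _ _ _ (x : Fin p × Fin q → K) =>
      ∀ u : K ⊗[k] L, ∀ v ∈ liftPoint A B K (grassmannianChart b K x),
        ⁅u, v⁆ ∈ liftPoint A B K (grassmannianChart b K x) :=
  (isConstructibleCondition_lie_mem b (fun y : L => 1 ⊗ₜ y) (chartGenerators b)).congr
    fun K _ _ _ x => by
      simp only [← liftPoint_chart_eq_span b x hAB, specialize_tmul, map_one, span_range_one_tmul,
        Submodule.mem_top, forall_const]

/-- The codimension of `H ∩ N` in `H` is the rank of the images of the generators of `H` modulo
`N`. -/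
theorem rank_quotient_submoduleOf_liftPoint (hAB : A ≤ B) (N : Submodule k L) :
    Module.rank K (liftPoint A B K (grassmannianChart b K x) ⧸
        (N.baseChange K).submoduleOf (liftPoint A B K (grassmannianChart b K x))) =
      Module.rank K (Submodule.span K (Set.range fun a => specialize x
        (N.mkQ.baseChange (MvPolynomial (Fin p × Fin q) k) (chartGenerators b a)))) := by
  have h0 : (fun a => specialize x (N.mkQ.baseChange (MvPolynomial (Fin p × Fin q) k)
      (chartGenerators b a))) =
      fun a => N.mkQ.baseChange K (specialize x (chartGenerators b a)) :=
    funext fun a => specialize_baseChange x _ _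
  rw [h0]
  set H := liftPoint A B K (grassmannianChart b K x) with hH
  have h1 : (N.baseChange K).submoduleOf H =
      LinearMap.ker (N.mkQ.baseChange K ∘ₗ H.subtype) := by
    ext z
    exact mem_baseChange_iff_mkQ K N z
  have h2 : Submodule.span K (Set.range fun a =>
      N.mkQ.baseChange K (specialize x (chartGenerators b a))) =
      LinearMap.range (N.mkQ.baseChange K ∘ₗ H.subtype) := by
    rw [LinearMap.range_comp, Submodule.range_subtype, hH, liftPoint_chart_eq_span b x hAB,
      Submodule.map_span, ← Set.range_comp]
    rfl
  rw [h1, h2]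
  exact (LinearMap.quotKerEquivRange _).rank_eq

theorem rank_eq_natCast_iff {M M' : Type*} [AddCommGroup M] [Module K M] [AddCommGroup M']
    [Module K M'] (e : M ≃ₗ[K] M') (n : ℕ) : Module.rank K M = n ↔ Module.rank K M' = n := by
  rw [← Cardinal.lift_inj, e.lift_rank_eq, Cardinal.lift_natCast, Cardinal.lift_eq_nat_iff]

/-- The codimension of `H ∩ N` in `N` is the rank of the restriction to `N` of the equations of
`H`. -/
theorem rank_quotient_liftPoint_submoduleOf {N : Submodule k L} (hN : N ≤ B) (n : ℕ) :
    Module.rank K (N.baseChange K ⧸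
        (liftPoint A B K (grassmannianChart b K x)).submoduleOf (N.baseChange K)) = n ↔
      Module.rank K (Submodule.span K (Set.range fun y : N => specialize x
        (chartEquations b MvPolynomial.X ((projQuot A B).baseChange
          (MvPolynomial (Fin p × Fin q) k) (1 ⊗ₜ (y : L)))))) = n := by
  set f := chartEquations b x ∘ₗ (projQuot A B).baseChange K with hf
  have h0 : (fun y : N => specialize x (chartEquations b MvPolynomial.X
      ((projQuot A B).baseChange (MvPolynomial (Fin p × Fin q) k) (1 ⊗ₜ (y : L))))) =
      fun y : N => f (1 ⊗ₜ (y : L)) :=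
    funext fun y => by
      rw [specialize_chartEquations, specialize_baseChange, specialize_tmul, map_one]
      rfl
  rw [h0]
  have h1 : (liftPoint A B K (grassmannianChart b K x)).submoduleOf (N.baseChange K) =
      LinearMap.ker (f ∘ₗ (N.baseChange K).subtype) := by
    ext z
    refine (mem_liftPoint_chart_iff b x z).trans (and_iff_right ?_)
    exact (mem_baseChange_iff_mkQ K B z).1 (Submodule.baseChange_mono K hN z.2)
  have h2 : Submodule.span K (Set.range fun y : N => f (1 ⊗ₜ (y : L))) =
      LinearMap.range (f ∘ₗ (N.baseChange K).subtype) := by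
    rw [LinearMap.range_comp, Submodule.range_subtype, Submodule.baseChange_eq_span,
      Submodule.map_span]
    congr 1
    ext z
    simp
  rw [h1]
  rw [h2]
  exact rank_eq_natCast_iff (LinearMap.quotKerEquivRange _) n

/-- The relative codimension is a sum of two ranks of polynomial families, so that its fibres are
finite unions of constructible sets. -/
theorem isConstructibleCondition_relCodim_eq (hAB : A ≤ B) {N : Submodule k L} (hN : N ≤ B)
    (n : ℕ) :
    IsConstructibleCondition (k := k) fun K _ _ _ (x : Fin p × Fin q → K) =>
      Module.rank K (liftPoint A B K (grassmannianChart b K x) ⧸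
          (N.baseChange K).submoduleOf (liftPoint A B K (grassmannianChart b K x))) +
        Module.rank K (N.baseChange K ⧸
          (liftPoint A B K (grassmannianChart b K x)).submoduleOf (N.baseChange K)) = n := by
  refine (IsConstructibleCondition.exists_of_finite fun c : {c : Fin (n + 1) × Fin (n + 1) //
      (c.1 : ℕ) + c.2 = n} =>
    (isConstructibleCondition_rank_eq (fun a =>
      N.mkQ.baseChange (MvPolynomial (Fin p × Fin q) k) (chartGenerators b a)) c.1.1).and
    (isConstructibleCondition_rank_eq (fun y : N => chartEquations b MvPolynomial.X
      ((projQuot A B).baseChange (MvPolynomial (Fin p × Fin q) k) (1 ⊗ₜ (y : L))))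
        c.1.2)).congr fun K _ _ _ x => ?_
  simp only [← rank_quotient_submoduleOf_liftPoint b x hAB N,
    ← rank_quotient_liftPoint_submoduleOf b x hN]
  constructor
  · intro h
    obtain ⟨r, hr⟩ := Cardinal.lt_aleph0.1
      (lt_of_le_of_lt (h ▸ self_le_add_right _ _) Cardinal.natCast_lt_aleph0)
    obtain ⟨s, hs⟩ := Cardinal.lt_aleph0.1
      (lt_of_le_of_lt (h ▸ self_le_add_left _ _) Cardinal.natCast_lt_aleph0)
    rw [hr, hs] at h
    have h' : r + s = n := by exact_mod_cast h
    exact ⟨⟨(⟨r, by lia⟩, ⟨s, by lia⟩), h'⟩, hr, hs⟩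
  · rintro ⟨⟨c, hc⟩, h1, h2⟩
    rw [h1, h2]
    exact_mod_cast hc

/-- A point of a chart of the Grassmannian of `L / A` has codimension `q`. -/
theorem rank_quotient_liftPoint_top (b : Module.Basis (Fin p ⊕ Fin q) k
    ((⊤ : Submodule k L) ⧸ A.submoduleOf ⊤)) :
    Module.rank K ((K ⊗[k] L) ⧸ liftPoint A ⊤ K (grassmannianChart b K x)) = q := by
  set f := chartEquations b x ∘ₗ (projQuot A ⊤).baseChange K with hf
  have h1 : liftPoint A ⊤ K (grassmannianChart b K x) = LinearMap.ker f := by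
    ext z
    refine (mem_liftPoint_chart_iff b x z).trans (and_iff_right ?_)
    rw [← mem_baseChange_iff_mkQ, Submodule.baseChange_top]
    exact Submodule.mem_top
  have hproj : Function.Surjective (projQuot A (⊤ : Submodule k L)) := by
    intro w
    refine ⟨quotRep w, ?_⟩
    have := LinearMap.congr_fun (projQuot_comp_subtype (A := A) (B := ⊤)) (quotRep w)
    exact this.trans (mkQ_quotRep w)
  have hsurj : Function.Surjective f :=
    (chartEquations_surjective b x).comp (LinearMap.baseChange_surjective K hproj)
  rw [h1, rank_eq_natCast_iff (f.quotKerEquivOfSurjective hsurj)]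
  simp

end ChartPoint

/-! ### Constructibility of classes of closed subalgebras and ideals -/

section Classes

variable {k : Type u} [Field k] {L : Type v} [LieRing L] [LieAlgebra k L]

theorem isClosedSubspace_of_le {K : Type u} [Field K] {M : Type v} [AddCommGroup M] [Module K M]
    {J : Type} {F : J → Submodule K M} {H : Submodule K M} {j : J} (h : F j ≤ H) :
    IsClosedSubspace F H :=
  le_antisymm ((iInf_le _ j).trans (sup_eq_left.2 h).le) (le_iInf fun _ => le_sup_left)

theorem exists_lieSubalgebra_toSubmodule_eq_iff {K : Type u} [Field K] {M : Type v} [LieRing M]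
    [LieAlgebra K M] (P : LieSubalgebra K M → Prop) (Q : Submodule K M → Prop)
    (hPQ : ∀ H : LieSubalgebra K M, P H ↔ Q H.toSubmodule) (N : Submodule K M) :
    (∃ H, P H ∧ H.toSubmodule = N) ↔ (∀ u ∈ N, ∀ v ∈ N, ⁅u, v⁆ ∈ N) ∧ Q N := by
  constructor
  · rintro ⟨H, hH, rfl⟩
    exact ⟨fun u hu v hv => H.lie_mem hu hv, (hPQ H).1 hH⟩
  · rintro ⟨h, hQ⟩
    let H : LieSubalgebra K M := { N with lie_mem' := fun {u v} hu hv => h u hu v hv }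
    exact ⟨H, (hPQ H).2 hQ, rfl⟩

variable {F : ℕ → Submodule k L} (l n : ℕ)

theorem isConstructibleFamily_closedSubalgebras
    (hfin : FiniteDimensional k ((⊤ : Submodule k L) ⧸ (F l).submoduleOf ⊤)) :
    IsConstructibleFamily (grassmannianPoints (F l) ⊤ (codimPart (closedSubalgebras F) n)) := by
  refine ⟨hfin, fun p q b => ((isConstructibleCondition_subalgebra b le_top).and
    (.const (q = n))).congr fun K _ _ _ x => ?_⟩
  refine (mem_grassmannianPoints_iff le_top _ _).trans
    ((exists_lieSubalgebra_toSubmodule_eq_iff _ (fun H =>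
    IsClosedSubspace (fun j => (F j).baseChange K) H ∧
      Module.rank K ((K ⊗[k] L) ⧸ H) = n) (fun H => Iff.rfl) _).trans ?_)
  rw [rank_quotient_liftPoint_top, Nat.cast_inj,
    and_iff_right (isClosedSubspace_of_le (baseChange_le_liftPoint le_top _))]

theorem isConstructibleFamily_closedIdeals
    (hfin : FiniteDimensional k ((⊤ : Submodule k L) ⧸ (F l).submoduleOf ⊤)) :
    IsConstructibleFamily (grassmannianPoints (F l) ⊤ (codimPart (closedIdeals F) n)) := by
  refine ⟨hfin, fun p q b => ((isConstructibleCondition_subalgebra b le_top).and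
    ((isConstructibleCondition_ideal b le_top).and
    (.const (q = n)))).congr fun K _ _ _ x => ?_⟩
  refine (mem_grassmannianPoints_iff le_top _ _).trans
    ((exists_lieSubalgebra_toSubmodule_eq_iff _ (fun H =>
    (IsClosedSubspace (fun j => (F j).baseChange K) H ∧ ∀ u : K ⊗[k] L, ∀ v ∈ H, ⁅u, v⁆ ∈ H) ∧
      Module.rank K ((K ⊗[k] L) ⧸ H) = n) (fun H => Iff.rfl) _).trans ?_)
  rw [rank_quotient_liftPoint_top, Nat.cast_inj,
    and_iff_right (isClosedSubspace_of_le (baseChange_le_liftPoint le_top _))]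

end Classes

section ClassesZ

variable {k : Type u} [Field k] {L : Type v} [LieRing L] [LieAlgebra k L]
  {F : ℤ → Submodule k L} (hF : Antitone F) (l n : ℕ)

theorem isCommensurableWith_of_rank_add_eq {K : Type u} [Field K] {M : Type v} [AddCommGroup M]
    [Module K M] {H N : Submodule K M} {n : ℕ}
    (h : Module.rank K (H ⧸ N.submoduleOf H) + Module.rank K (N ⧸ H.submoduleOf N) = n) :
    IsCommensurableWith H N :=
  ⟨Module.rank_lt_aleph0_iff.1 (lt_of_le_of_lt (h ▸ self_le_add_right _ _)
      Cardinal.natCast_lt_aleph0),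
    Module.rank_lt_aleph0_iff.1 (lt_of_le_of_lt (h ▸ self_le_add_left _ _)
      Cardinal.natCast_lt_aleph0)⟩

include hF

theorem isConstructibleFamily_commensurable_closedSubalgebras
    (hfin : FiniteDimensional k (F (-l) ⧸ (F l).submoduleOf (F (-l)))) :
    IsConstructibleFamily (grassmannianPoints (F l) (F (-l))
      (relCodimPart F (commensurableIn F (closedSubalgebras F)) n)) := by
  have hl : F l ≤ F (-l) := hF (by lia)
  refine ⟨hfin, fun p q b => ((isConstructibleCondition_subalgebra b hl).and
    (isConstructibleCondition_relCodim_eq b hl (hF (by lia : -(l : ℤ) ≤ 0)) n)).congr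
      fun K _ _ _ x => ?_⟩
  refine (mem_grassmannianPoints_iff hl _ _).trans
    ((exists_lieSubalgebra_toSubmodule_eq_iff _ (fun H =>
    (IsClosedSubspace (fun j => (F j).baseChange K) H ∧
      IsCommensurableWith H ((F 0).baseChange K)) ∧
      Module.rank K (H ⧸ ((F 0).baseChange K).submoduleOf H) +
        Module.rank K ((F 0).baseChange K ⧸ H.submoduleOf ((F 0).baseChange K)) = n)
        (fun H => Iff.rfl) _).trans ?_)
  exact and_congr_right fun _ => and_iff_right_of_imp fun h =>
    ⟨isClosedSubspace_of_le (baseChange_le_liftPoint hl _), isCommensurableWith_of_rank_add_eq h⟩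

theorem isConstructibleFamily_commensurable_closedIdeals
    (hfin : FiniteDimensional k (F (-l) ⧸ (F l).submoduleOf (F (-l)))) :
    IsConstructibleFamily (grassmannianPoints (F l) (F (-l))
      (relCodimPart F (commensurableIn F (closedIdeals F)) n)) := by
  have hl : F l ≤ F (-l) := hF (by lia)
  refine ⟨hfin, fun p q b => ((isConstructibleCondition_subalgebra b hl).and
    ((isConstructibleCondition_ideal b hl).and
    (isConstructibleCondition_relCodim_eq b hl (hF (by lia : -(l : ℤ) ≤ 0)) n))).congr
      fun K _ _ _ x => ?_⟩
  refine (mem_grassmannianPoints_iff hl _ _).trans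
    ((exists_lieSubalgebra_toSubmodule_eq_iff _ (fun H =>
    ((IsClosedSubspace (fun j => (F j).baseChange K) H ∧
      ∀ u : K ⊗[k] L, ∀ v ∈ H, ⁅u, v⁆ ∈ H) ∧ IsCommensurableWith H ((F 0).baseChange K)) ∧
      Module.rank K (H ⧸ ((F 0).baseChange K).submoduleOf H) +
        Module.rank K ((F 0).baseChange K ⧸ H.submoduleOf ((F 0).baseChange K)) = n)
        (fun H => Iff.rfl) _).trans ?_)
  refine and_congr_right fun _ => ⟨fun h => ⟨h.1.1.2, h.2⟩, fun h => ⟨⟨⟨?_, h.1⟩, ?_⟩, h.2⟩⟩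
  · exact isClosedSubspace_of_le (baseChange_le_liftPoint hl _)
  · exact isCommensurableWith_of_rank_add_eq h.2

end ClassesZ

/-! ### Filtered Lie algebras and subalgebras of finite codimension -/

section Filtration

/-- A decreasing family of subspaces of a space of dimension at most `n` drops at most `n`
times. -/
theorem card_le_of_antitone {K M ι : Type*} [Field K] [AddCommGroup M] [Module K M]
    [LinearOrder ι] [NoMaxOrder ι] {D : ι → Submodule K M} (hD : Antitone D) {n : ℕ}
    (hn : Module.rank K M ≤ n) (J : Finset ι)
    (hJ : ∀ r ∈ J, ∃ v ∈ D r, ∀ s, r < s → v ∉ D s) : J.card ≤ n := by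
  have : Module.Finite K M :=
    Module.rank_lt_aleph0_iff.1 (lt_of_le_of_lt hn Cardinal.natCast_lt_aleph0)
  have hn' : Module.finrank K M ≤ n := Module.finrank_le_of_rank_le hn
  -- induction on `J`, adding the largest element; `N` is a space below all drops in `J`
  have key : ∀ J : Finset ι, (∀ r ∈ J, ∃ v ∈ D r, ∀ s, r < s → v ∉ D s) →
      ∀ N : Submodule K M, (∀ r ∈ J, N ≤ D r ∧ ∃ v ∈ D r, v ∉ N) →
        J.card + Module.finrank K N ≤ Module.finrank K M := by
    intro J
    induction J using Finset.induction_on_max with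
    | empty => intro _ N _; simpa using N.finrank_le
    | insert a J ha ih =>
      intro hJ N hN
      have h1 := ih (fun r hr => hJ r (Finset.mem_insert_of_mem hr)) (D a) fun r hr => by
        obtain ⟨v, hv, hv'⟩ := hJ r (Finset.mem_insert_of_mem hr)
        exact ⟨hD (ha r hr).le, v, hv, hv' a (ha r hr)⟩
      obtain ⟨h2, v, hv, hv'⟩ := hN a (Finset.mem_insert_self a J)
      have h3 : Module.finrank K N < Module.finrank K (D a) :=
        Submodule.finrank_lt_finrank_of_lt (lt_of_le_of_ne h2 fun h => hv' (h ▸ hv))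
      rw [Finset.card_insert_of_notMem fun h => lt_irrefl a (ha a h)]
      lia
  refine (le_of_add_le_left (key J hJ ⊥ fun r hr => ⟨bot_le, ?_⟩)).trans hn'
  obtain ⟨v, hv, hv'⟩ := hJ r hr
  obtain ⟨s, hs⟩ := exists_gt r
  exact ⟨v, hv, fun h => hv' s hs ((Submodule.mem_bot K).1 h ▸ zero_mem _)⟩

variable {K : Type*} [CommRing K] {M : Type*} [LieRing M] [LieAlgebra K M]

/-- The brackets of total degree `r` of elements of a filtered Lie algebra whose degrees are not
in `J`. -/
def bracketsAvoiding (G : ℕ → Submodule K M) (J : Finset ℕ) (r : ℕ) : Set M :=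
  {w | ∃ a b : ℕ, a ∉ J ∧ b ∉ J ∧ a + b = r ∧ ∃ x ∈ G a, ∃ y ∈ G b, ⁅x, y⁆ = w}

end Filtration

section Bound

variable {K : Type*} [Field K] {M : Type*} [LieRing M] [LieAlgebra K M]

/-- Let `H` be a closed subalgebra of codimension at most `n`. There is a set `J` of at most `n`
degrees outside which `H` contains all leading terms. If `J` contained some `r ≥ N`, then by `hgen`
the leading terms of degree `r` would be sums of brackets of leading terms of `H`. -/
theorem filtration_le_of_rank_le {G : ℕ → Submodule K M} (hG : Antitone G)
    (hlie : ∀ a b, ∀ x ∈ G a, ∀ y ∈ G b, ⁅x, y⁆ ∈ G (a + b)) {n N : ℕ}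
    (hgen : ∀ (r : ℕ) (J : Finset ℕ), r ∈ J → J.card ≤ n → N ≤ r →
      G r ≤ G (r + 1) ⊔ Submodule.span K (bracketsAvoiding G J r))
    {H : LieSubalgebra K M} (hH : ⨅ r, (H.toSubmodule ⊔ G r) ≤ H.toSubmodule)
    (hn : Module.rank K (G 0 ⧸ H.toSubmodule.submoduleOf (G 0)) ≤ n) : G N ≤ H.toSubmodule := by
  classical
  have hstep : ∀ r ≥ N, G r ≤ H.toSubmodule ⊔ G (r + 1) := by
    intro r hr
    by_contra hjump
    let J := (Finset.range (r + 1)).filter fun a => ¬ G a ≤ H.toSubmodule ⊔ G (a + 1)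
    have hcard : J.card ≤ n := by
      refine card_le_of_antitone (D := fun a => ((G a).submoduleOf (G 0)).map
        (H.toSubmodule.submoduleOf (G 0)).mkQ)
        (fun a b hab => Submodule.map_mono (Submodule.comap_mono (hG hab))) hn J fun a ha => ?_
      obtain ⟨v, hv, hv'⟩ := SetLike.not_le_iff_exists.1 (Finset.mem_filter.1 ha).2
      refine ⟨_, ⟨⟨v, hG (Nat.zero_le a) hv⟩, hv, rfl⟩, ?_⟩
      rintro s hs ⟨w, hw, hvw⟩
      rw [← sub_eq_zero, ← map_sub, ← LinearMap.mem_ker, Submodule.ker_mkQ] at hvw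
      have hvw' : (w : M) - v ∈ H.toSubmodule := hvw
      refine hv' ?_
      rw [show v = -((w : M) - v) + w by abel]
      exact add_mem (Submodule.mem_sup_left (neg_mem hvw'))
        (Submodule.mem_sup_right (hG (Nat.succ_le_of_lt hs) hw))
    refine hjump ((hgen r J (Finset.mem_filter.2 ⟨Finset.self_mem_range_succ r, hjump⟩) hcard
      hr).trans (sup_le le_sup_right (Submodule.span_le.2 ?_)))
    rintro _ ⟨a, b, ha, hb, hab, x, hx, y, hy, rfl⟩
    have hJ : ∀ c ≤ r, c ∉ J → G c ≤ H.toSubmodule ⊔ G (c + 1) := fun c hc hcJ => by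
      by_contra h
      exact hcJ (Finset.mem_filter.2 ⟨Finset.mem_range.2 (by lia), h⟩)
    -- replace `x` and `y` by elements of `H` with the same leading terms
    obtain ⟨h, hh, g, hg, rfl⟩ := Submodule.mem_sup.1 (hJ a (by lia) ha hx)
    obtain ⟨h', hh', g', hg', rfl⟩ := Submodule.mem_sup.1 (hJ b (by lia) hb hy)
    have hha : h ∈ G a := by
      simpa using sub_mem hx (hG (Nat.le_succ a) hg)
    rw [lie_add, add_lie, SetLike.mem_coe, add_assoc]
    refine add_mem (Submodule.mem_sup_left (H.lie_mem hh hh')) (Submodule.mem_sup_right ?_)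
    refine add_mem ?_ ?_
    · have := hlie _ _ _ hg _ (by simpa using sub_mem hy (hG (Nat.le_succ b) hg') : h' ∈ G b)
      rwa [show a + 1 + b = r + 1 by lia] at this
    · have := hlie _ _ _ hx _ hg'
      rwa [show a + (b + 1) = r + 1 by lia] at this
  refine le_trans (le_iInf fun r => ?_) hH
  rcases le_total r N with h | h
  · exact (hG h).trans le_sup_right
  · induction r, h using Nat.le_induction with
    | base => exact le_sup_right
    | succ r hr ih => exact ih.trans (sup_le le_sup_left (hstep r hr))

/-- Let `H` be a subalgebra which contains `G N` and has dimension at most `n` modulo `G 0`. If an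
element of `H` had leading degree `d` less than `-(N + (n + 1) m)`, then its brackets with elements
of `G N` would have `n + 1` different negative leading degrees, and so would be linearly independent
modulo `G 0`. -/
theorem le_filtration_of_rank_le {G : ℤ → Submodule K M} (hG : Antitone G)
    (hex : ∀ z, ∃ d, z ∈ G d) {n N m : ℕ} {H : LieSubalgebra K M}
    (hN : G N ≤ H.toSubmodule)
    (hlead : ∀ z : M, ∀ d < 0, z ∈ G d → z ∉ G (d + 1) →
      ∃ μ c : ℤ, 0 < μ ∧ μ ≤ m ∧ 0 ≤ c ∧ c < μ ∧
        ∀ j : ℕ, ∃ y ∈ G (N + c + j * μ),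
          ⁅z, y⁆ ∈ G (d + (N + c + j * μ)) ∧ ⁅z, y⁆ ∉ G (d + (N + c + j * μ) + 1))
    (hn : Module.rank K (H.toSubmodule ⧸ (G 0).submoduleOf H.toSubmodule) ≤ n) :
    H.toSubmodule ≤ G (-(N + (n + 1) * m : ℕ)) := by
  intro z hz
  by_contra hzG
  obtain ⟨d, hd, hmax⟩ := Int.exists_greatest_of_bdd (P := fun d => z ∈ G d)
    ⟨-(N + (n + 1) * m : ℕ), fun d hd => le_of_not_gt fun h => hzG (hG h.le hd)⟩ (hex z)
  have hd1 : z ∉ G (d + 1) := fun h => by have := hmax _ h; lia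
  have hdlt : d < -(N + (n + 1) * m : ℕ) := lt_of_not_ge fun h => hzG (hG h hd)
  obtain ⟨μ, c, hμ, hμm, hc, hcμ, hy⟩ := hlead z d (by lia) hd hd1
  choose y hy hyd hyd' using hy
  let e : ℕ → ℤ := fun j => d + (N + c + j * μ)
  have he : ∀ j < n + 1, e j < 0 := by
    intro j hj
    have h1 : (j : ℤ) * μ ≤ n * m :=
      mul_le_mul (by lia) hμm hμ.le (by positivity)
    simp only [e]
    push_cast at hdlt
    linarith
  have hinj : Function.Injective e := fun i j hij => by
    simp only [e, add_right_inj] at hij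
    exact_mod_cast mul_right_cancel₀ hμ.ne' hij
  have hcard := card_le_of_antitone (D := fun a => ((G a).submoduleOf H.toSubmodule).map
    ((G 0).submoduleOf H.toSubmodule).mkQ)
    (fun a b hab => Submodule.map_mono (Submodule.comap_mono (hG hab))) hn
    ((Finset.range (n + 1)).image e) (by
      intro a ha
      obtain ⟨j, hj, rfl⟩ := Finset.mem_image.1 ha
      have hjμ : 0 ≤ (j : ℤ) * μ := by positivity
      have hyH : y j ∈ H.toSubmodule := hN (hG (by lia) (hy j))
      refine ⟨_, ⟨⟨⁅z, y j⁆, H.lie_mem hz hyH⟩, hyd j, rfl⟩, ?_⟩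
      rintro s hs ⟨w, hw, hvw⟩
      rw [← sub_eq_zero, ← map_sub, ← LinearMap.mem_ker, Submodule.ker_mkQ] at hvw
      have hvw' : (w : M) - ⁅z, y j⁆ ∈ G 0 := hvw
      refine hyd' j ?_
      rw [show ⁅z, y j⁆ = (w : M) - (w - ⁅z, y j⁆) by abel]
      exact sub_mem (hG (by simpa [e] using hs) hw)
        (hG (by have := he j (Finset.mem_range.1 hj); simp only [e] at this; lia) hvw'))
  rw [Finset.card_image_of_injective _ hinj, Finset.card_range] at hcard
  lia

end Bound

section FiltrationBaseChange

variable {k : Type u} [Field k] (K : Type u) [Field K] [Algebra k K] {L : Type*} [LieRing L]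
  [LieAlgebra k L]

theorem lie_mem_baseChange {P Q R : Submodule k L} (h : ∀ x ∈ P, ∀ y ∈ Q, ⁅x, y⁆ ∈ R)
    (x : K ⊗[k] L) (hx : x ∈ P.baseChange K) (y : K ⊗[k] L) (hy : y ∈ Q.baseChange K) :
    ⁅x, y⁆ ∈ R.baseChange K := by
  rw [Submodule.baseChange_eq_span] at hx hy
  induction hx using Submodule.span_induction with
  | zero => rw [zero_lie]; exact zero_mem _
  | add u u' _ _ h h' => rw [add_lie]; exact add_mem h h'
  | smul c u _ h => rw [smul_lie]; exact Submodule.smul_mem _ c h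
  | mem u hu =>
    induction hy using Submodule.span_induction with
    | zero => rw [lie_zero]; exact zero_mem _
    | add u u' _ _ h h' => rw [lie_add]; exact add_mem h h'
    | smul c u _ h => rw [lie_smul]; exact Submodule.smul_mem _ c h
    | mem v hv =>
      obtain ⟨x, hx, rfl⟩ := hu
      obtain ⟨y, hy, rfl⟩ := hv
      simp only [TensorProduct.mk_apply, LieAlgebra.ExtendScalars.bracket_tmul]
      exact Submodule.tmul_mem_baseChange_of_mem _ (h x hx y hy)

theorem baseChange_le_sup_span_bracketsAvoiding {F : ℕ → Submodule k L} {J : Finset ℕ} {r : ℕ}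
    (h : F r ≤ F (r + 1) ⊔ Submodule.span k (bracketsAvoiding F J r)) :
    (F r).baseChange K ≤ (F (r + 1)).baseChange K ⊔
      Submodule.span K (bracketsAvoiding (fun a => (F a).baseChange K) J r) := by
  rw [Submodule.baseChange_eq_span K (F r), Submodule.span_le]
  rintro _ ⟨x, hx, rfl⟩
  obtain ⟨y, hy, z, hz, rfl⟩ := Submodule.mem_sup.1 (h hx)
  rw [map_add]
  refine add_mem (Submodule.mem_sup_left (Submodule.tmul_mem_baseChange_of_mem _ hy))
    (Submodule.mem_sup_right ?_)
  clear hx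
  induction hz using Submodule.span_induction with
  | zero => rw [map_zero]; exact zero_mem _
  | add u u' _ _ h h' => rw [map_add]; exact add_mem h h'
  | smul c u _ h =>
    rw [map_smul, ← algebraMap_smul K c]
    exact Submodule.smul_mem _ _ h
  | mem w hw =>
    obtain ⟨a, b, ha, hb, hab, x, hx, y, hy, rfl⟩ := hw
    refine Submodule.subset_span ⟨a, b, ha, hb, hab, 1 ⊗ₜ x,
      Submodule.tmul_mem_baseChange_of_mem _ hx, 1 ⊗ₜ y,
      Submodule.tmul_mem_baseChange_of_mem _ hy, ?_⟩
    simp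

theorem finite_quotient_of_ker_le {V W : Type*} [AddCommGroup V] [Module k V] [AddCommGroup W]
    [Module k W] [FiniteDimensional k W] (f : V →ₗ[k] W) {A B : Submodule k V}
    (h : ∀ z ∈ B, f z = 0 → z ∈ A) : FiniteDimensional k (B ⧸ A.submoduleOf B) := by
  have h1 : LinearMap.ker (f ∘ₗ B.subtype) ≤ A.submoduleOf B := fun z hz => h z z.2 hz
  have : FiniteDimensional k (B ⧸ LinearMap.ker (f ∘ₗ B.subtype)) :=
    Module.Finite.equiv (LinearMap.quotKerEquivRange (f ∘ₗ B.subtype)).symm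
  exact Module.Finite.of_surjective _ (Submodule.factor_surjective h1)

end FiltrationBaseChange

/-! ### Automorphisms of finite order of simple Lie algebras -/

section Eigenspaces

variable {k : Type u} [Field k] {𝔤 : Type v} [LieRing 𝔤] [LieAlgebra k 𝔤]

/-- The eigenspace `𝔤ₙ` of the automorphism `σ` for the eigenvalue `εⁿ`. -/
def twistEigenspace (ε : kˣ) (σ : 𝔤 ≃ₗ⁅k⁆ 𝔤) (n : ℤ) : Submodule k 𝔤 where
  carrier := {x | σ x = ((ε ^ n : kˣ) : k) • x}
  zero_mem' := by simp
  add_mem' {x y} hx hy := by simp_all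
  smul_mem' r x hx := by
    rw [Set.mem_ofPred_eq] at hx ⊢
    rw [map_smul, hx, smul_comm]

variable {ε : kˣ} {σ : 𝔤 ≃ₗ⁅k⁆ 𝔤} {m : ℕ}

theorem mem_twistEigenspace {n : ℤ} {x : 𝔤} :
    x ∈ twistEigenspace ε σ n ↔ σ x = ((ε ^ n : kˣ) : k) • x := Iff.rfl

theorem lie_mem_twistEigenspace {a b : ℤ} {x y : 𝔤} (hx : x ∈ twistEigenspace ε σ a)
    (hy : y ∈ twistEigenspace ε σ b) : ⁅x, y⁆ ∈ twistEigenspace ε σ (a + b) := by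
  rw [mem_twistEigenspace] at *
  rw [LieEquiv.map_lie, hx, hy, smul_lie, lie_smul, smul_smul, ← Units.val_mul, ← zpow_add]

theorem twistEigenspace_congr {a b : ℤ} (h : ε ^ a = ε ^ b) :
    twistEigenspace ε σ a = twistEigenspace ε σ b := by
  ext x
  rw [mem_twistEigenspace, mem_twistEigenspace, h]

theorem zpow_eq_of_dvd_sub (hε : ε ^ m = 1) {a b : ℤ} (h : (m : ℤ) ∣ a - b) :
    ε ^ a = ε ^ b := by
  obtain ⟨c, hc⟩ := h
  rw [show a = b + m * c by lia, zpow_add, zpow_mul, zpow_natCast, hε, one_zpow, mul_one]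

theorem twistEigenspace_eq_of_dvd_sub (hε : ε ^ m = 1) {a b : ℤ} (h : (m : ℤ) ∣ a - b) :
    twistEigenspace ε σ a = twistEigenspace ε σ b :=
  twistEigenspace_congr (zpow_eq_of_dvd_sub hε h)

variable (ε σ m) in
/-- The projection onto the eigenspace `𝔤ₙ` for an automorphism `σ` with `σ ^ m = 1`: the average
of the maps `ε ^ (-n j) σ ^ j`. -/
noncomputable def eigenProj (n : ℤ) : 𝔤 →ₗ[k] 𝔤 :=
  (m : k)⁻¹ • ∑ j ∈ Finset.range m,
    ((ε ^ (-(n * j)) : kˣ) : k) • (σ.toLinearEquiv.toLinearMap ^ j : Module.End k 𝔤)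

theorem eigenProj_apply (n : ℤ) (x : 𝔤) :
    eigenProj ε σ m n x =
      (m : k)⁻¹ • ∑ j ∈ Finset.range m, ((ε ^ (-(n * j)) : kˣ) : k) • σ^[j] x := by
  simp only [eigenProj, LinearMap.smul_apply, LinearMap.sum_apply, Module.End.pow_apply]
  rfl

open Classical in
theorem geom_sum_of_pow_eq_one {z : k} (hz : z ^ m = 1) :
    ∑ j ∈ Finset.range m, z ^ j = if z = 1 then (m : k) else 0 := by
  split_ifs with h
  · simp [h]
  · have := geom_sum_mul z m
    rw [hz, sub_self] at this
    exact (mul_eq_zero.1 this).resolve_right (sub_ne_zero.2 h)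

theorem eigenProj_mem (hε : ε ^ m = 1) (hσ : σ^[m] = id) (n : ℤ) (x : 𝔤) :
    eigenProj ε σ m n x ∈ twistEigenspace ε σ n := by
  rw [mem_twistEigenspace, eigenProj_apply, map_smul, map_sum]
  -- applying `σ` shifts the summation index, and the summands are periodic in `j`
  let g : ℕ → 𝔤 := fun j => ((ε ^ (n - n * j) : kˣ) : k) • σ^[j] x
  have hg : g m = g 0 := by
    simp only [g, hσ, Function.iterate_zero, id]
    congr 2
    exact zpow_eq_of_dvd_sub hε ⟨-n, by push_cast; ring⟩
  have h1 := Finset.sum_range_succ g m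
  rw [Finset.sum_range_succ', hg, add_left_inj] at h1
  have h2 : ((ε ^ n : kˣ) : k) • ∑ j ∈ Finset.range m, ((ε ^ (-(n * j)) : kˣ) : k) • σ^[j] x =
      ∑ j ∈ Finset.range m, g j := by
    rw [Finset.smul_sum]
    refine Finset.sum_congr rfl fun j _ => ?_
    simp only [g, smul_smul, ← Units.val_mul, ← zpow_add]
    rfl
  rw [smul_comm, h2, ← h1]
  congr 1
  refine Finset.sum_congr rfl fun j _ => ?_
  simp only [g, map_smul, Function.iterate_succ_apply']
  congr 3
  push_cast
  ring

theorem span_lie_eq_top [LieAlgebra.IsSimple k 𝔤] :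
    Submodule.span k {w : 𝔤 | ∃ u v : 𝔤, ⁅u, v⁆ = w} = ⊤ := by
  have h1 : ⁅(⊤ : LieIdeal k 𝔤), (⊤ : LieIdeal k 𝔤)⁆ = ⊤ := by
    refine (LieAlgebra.IsSimple.eq_bot_or_eq_top _).resolve_left fun h => ?_
    refine LieAlgebra.IsSimple.non_abelian k (L := 𝔤) ⟨fun x y => ?_⟩
    have := LieSubmodule.lie_mem_lie (I := (⊤ : LieIdeal k 𝔤)) (N := (⊤ : LieIdeal k 𝔤))
      (LieSubmodule.mem_top x) (LieSubmodule.mem_top y)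
    rw [h] at this
    exact (LieSubmodule.mem_bot _).1 this
  have h2 := LieSubmodule.lieIdeal_oper_eq_linear_span' (I := (⊤ : LieIdeal k 𝔤))
    (N := (⊤ : LieIdeal k 𝔤))
  rw [h1] at h2
  rw [eq_top_iff, ← LieSubmodule.top_toSubmodule (R := k) (L := 𝔤) (M := 𝔤), h2]
  refine Submodule.span_mono ?_
  rintro _ ⟨u, _, v, _, rfl⟩
  exact ⟨u, v, rfl⟩

variable [CharZero k] (hm : 0 < m)
include hm

theorem sum_eigenProj (hε : IsPrimitiveRoot ε m) (x : 𝔤) :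
    ∑ n ∈ Finset.range m, eigenProj ε σ m n x = x := by
  have hm' : (m : k) ≠ 0 := by exact_mod_cast hm.ne'
  simp only [eigenProj_apply]
  rw [← Finset.smul_sum, Finset.sum_comm, inv_smul_eq_iff₀ hm']
  simp only [← Finset.sum_smul]
  rw [Finset.sum_eq_single_of_mem 0 (Finset.mem_range.2 hm)]
  · simp
  · intro j hj hj0
    have h1 : (((ε ^ (-(j : ℤ)) : kˣ) : k)) ^ m = 1 := by
      rw [← Units.val_pow_eq_pow_val, ← zpow_natCast, zpow_comm, zpow_natCast ε m, hε.pow_eq_one]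
      simp
    have h2 : ((ε ^ (-(j : ℤ)) : kˣ) : k) ≠ 1 := by
      rw [Ne, Units.val_eq_one, zpow_neg, inv_eq_one, zpow_natCast]
      exact hε.pow_ne_one_of_pos_of_lt hj0 (Finset.mem_range.1 hj)
    have h3 := geom_sum_of_pow_eq_one h1
    rw [if_neg h2] at h3
    convert zero_smul k _ using 2
    rw [← h3]
    refine Finset.sum_congr rfl fun n _ => ?_
    rw [← Units.val_pow_eq_pow_val, ← zpow_natCast, ← zpow_mul]
    congr 2
    ring

open Classical in
theorem eigenProj_of_mem (hε : ε ^ m = 1) {b : ℤ} (n : ℤ) {x : 𝔤}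
    (hx : x ∈ twistEigenspace ε σ b) :
    eigenProj ε σ m n x = if ε ^ b = ε ^ n then x else 0 := by
  have hm' : (m : k) ≠ 0 := by exact_mod_cast hm.ne'
  have hit : ∀ j : ℕ, σ^[j] x = ((ε ^ (b * j) : kˣ) : k) • x := by
    intro j
    induction j with
    | zero => simp
    | succ j ih =>
      rw [Function.iterate_succ_apply', ih, map_smul, mem_twistEigenspace.1 hx, smul_smul,
        ← Units.val_mul, ← zpow_add]
      congr 3
      push_cast
      ring
  have h1 : (((ε ^ (b - n) : kˣ) : k)) ^ m = 1 := by
    rw [← Units.val_pow_eq_pow_val, ← zpow_natCast, zpow_comm, zpow_natCast ε m, hε]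
    simp
  have h2 : ((ε ^ (b - n) : kˣ) : k) = 1 ↔ ε ^ b = ε ^ n := by
    rw [Units.val_eq_one, zpow_sub, mul_inv_eq_one]
  rw [eigenProj_apply, inv_smul_eq_iff₀ hm']
  have h3 : ∑ j ∈ Finset.range m, ((ε ^ (-(n * j)) : kˣ) : k) • σ^[j] x =
      (∑ j ∈ Finset.range m, ((ε ^ (b - n) : kˣ) : k) ^ j) • x := by
    rw [Finset.sum_smul]
    refine Finset.sum_congr rfl fun j _ => ?_
    rw [hit, smul_smul, ← Units.val_mul, ← zpow_add, ← Units.val_pow_eq_pow_val, ← zpow_natCast,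
      ← zpow_mul]
    congr 3
    ring
  rw [h3, geom_sum_of_pow_eq_one h1]
  by_cases h : ε ^ b = ε ^ n
  · rw [if_pos h, if_pos (h2.2 h)]
  · rw [if_neg h, if_neg (mt h2.1 h), zero_smul, smul_zero]

/-- As `𝔤 = [𝔤, 𝔤]`, comparing the components in `𝔤ᵣ` gives `𝔤ᵣ = ∑ₐ [𝔤ₐ, 𝔤ᵣ₋ₐ]`. -/
theorem mem_span_lie_twistEigenspace [LieAlgebra.IsSimple k 𝔤] (hε : IsPrimitiveRoot ε m)
    (hσ : σ^[m] = id) (r : ℤ) {x : 𝔤} (hx : x ∈ twistEigenspace ε σ r) :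
    x ∈ Submodule.span k {w : 𝔤 | ∃ a : ℤ, ∃ u ∈ twistEigenspace ε σ a,
      ∃ v ∈ twistEigenspace ε σ (r - a), ⁅u, v⁆ = w} := by
  have h1 : eigenProj ε σ m r x = x := by
    rw [eigenProj_of_mem hm hε.pow_eq_one r hx, if_pos rfl]
  rw [← h1]
  have h2 : x ∈ Submodule.span k {w : 𝔤 | ∃ u v : 𝔤, ⁅u, v⁆ = w} := by
    rw [span_lie_eq_top]; trivial
  clear hx h1
  induction h2 using Submodule.span_induction with
  | zero => rw [map_zero]; exact zero_mem _
  | add u u' _ _ h h' => rw [map_add]; exact add_mem h h'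
  | smul c u _ h => rw [map_smul]; exact Submodule.smul_mem _ c h
  | mem w hw =>
    obtain ⟨u, v, rfl⟩ := hw
    rw [← sum_eigenProj (σ := σ) hm hε u, ← sum_eigenProj (σ := σ) hm hε v]
    simp only [sum_lie, lie_sum, map_sum]
    refine sum_mem fun b _ => sum_mem fun a _ => ?_
    rw [eigenProj_of_mem hm hε.pow_eq_one r (lie_mem_twistEigenspace
      (eigenProj_mem hε.pow_eq_one hσ _ u) (eigenProj_mem hε.pow_eq_one hσ _ v))]
    split_ifs with h
    · refine Submodule.subset_span ⟨a, _, eigenProj_mem hε.pow_eq_one hσ _ u, _, ?_, rfl⟩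
      have h' : twistEigenspace ε σ (r - a) = twistEigenspace ε σ b := by
        refine twistEigenspace_congr ?_
        rw [zpow_sub, ← h, zpow_add, mul_inv_cancel_comm]
      rw [h']
      exact eigenProj_mem hε.pow_eq_one hσ _ v
    · exact zero_mem _

/-- The centre of `𝔤 ⊗ K` is trivial, and this is seen by eigenvectors of `σ`. -/
theorem exists_lie_tmul_ne_zero [LieAlgebra.IsSimple k 𝔤] (hε : IsPrimitiveRoot ε m)
    (hσ : σ^[m] = id) {K : Type u} [Field K] [Algebra k K] {x : K ⊗[k] 𝔤} (hx : x ≠ 0) :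
    ∃ a : ℤ, ∃ y ∈ twistEigenspace ε σ a, ⁅x, (1 : K) ⊗ₜ[k] y⁆ ≠ 0 := by
  classical
  by_contra! h
  have h1 : ∀ y : 𝔤, ⁅x, (1 : K) ⊗ₜ[k] y⁆ = 0 := by
    intro y
    rw [← sum_eigenProj (σ := σ) hm hε y, TensorProduct.tmul_sum, lie_sum]
    exact Finset.sum_eq_zero fun n _ => h n _ (eigenProj_mem hε.pow_eq_one hσ _ y)
  -- the coordinates of `x` in a basis of `K` over `k` are central in `𝔤`
  let e := TensorProduct.equivFinsuppOfBasisLeft (N := 𝔤) (Module.Basis.ofVectorSpace k K)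
  have h2 (x : K ⊗[k] 𝔤) (y : 𝔤) (i) : e ⁅x, (1 : K) ⊗ₜ[k] y⁆ i = ⁅e x i, y⁆ := by
    induction x using TensorProduct.induction_on with
    | zero => simp
    | add z z' h h' => simp [h, h']
    | tmul c v =>
      simp only [e, LieAlgebra.ExtendScalars.bracket_tmul, mul_one,
        TensorProduct.equivFinsuppOfBasisLeft_apply_tmul_apply, smul_lie]
  refine hx (e.map_eq_zero_iff.1 (Finsupp.ext fun i => ?_))
  have h3 : e x i ∈ LieAlgebra.center k 𝔤 := by
    rw [LieModule.mem_maxTrivSubmodule]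
    intro y
    rw [← lie_skew, ← h2, h1, map_zero, Finsupp.zero_apply, neg_zero]
  rw [LieAlgebra.center_eq_bot] at h3
  exact (LieSubmodule.mem_bot _).1 h3

end Eigenspaces

/-! ### The degree filtration of the affine Lie algebra -/

section Loop

variable {k : Type u} [Field k] {𝔤 : Type v} [LieRing 𝔤]

@[simp] theorem AffineLie.loop_sub (z z' : AffineLie k 𝔤) : (z - z').loop = z.loop - z'.loop := rfl

@[simp] theorem AffineLie.c_sub (z z' : AffineLie k 𝔤) : (z - z').c = z.c - z'.c := rfl

@[simp] theorem AffineLie.d_sub (z z' : AffineLie k 𝔤) : (z - z').d = z.d - z'.d := rfl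

variable [LieAlgebra k 𝔤]

theorem loopBracket_single_apply (f : ℤ →₀ 𝔤) (n b : ℤ) (y : 𝔤) :
    loopBracket k 𝔤 f (Finsupp.single b y) (n + b) = ⁅f n, y⁆ := by
  induction f using Finsupp.induction_linear with
  | zero => simp
  | add f g hf hg => simp [hf, hg]
  | single a x =>
    rw [loopBracket_single]
    by_cases h : a = n
    · simp [h]
    · simp [h]

theorem loopBracket_apply_eq_zero {f g : ℤ →₀ 𝔤} {a b : ℤ} (hf : ∀ n < a, f n = 0)
    (hg : ∀ n < b, g n = 0) {n : ℤ} (hn : n < a + b) : loopBracket k 𝔤 f g n = 0 := by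
  rw [loopBracket_apply]
  refine Finset.sum_eq_zero fun i _ => Finset.sum_eq_zero fun j _ => ?_
  split_ifs with hij
  · rcases lt_or_ge i a with hi | hi
    · rw [hf i hi, zero_lie]
    · rw [hg j (by lia), lie_zero]
  · rfl

theorem loopCocycle_eq_zero {f g : ℤ →₀ 𝔤} {a b : ℤ} (hf : ∀ n < a, f n = 0)
    (hg : ∀ n < b, g n = 0) (hab : 0 < a + b) : loopCocycle k 𝔤 f g = 0 := by
  have h : loopCocycle k 𝔤 f g = ∑ i ∈ f.support, ∑ j ∈ g.support,
      if i + j = 0 then (i : k) * killingForm k 𝔤 (f i) (g j) else 0 := by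
    conv_lhs => rw [← Finsupp.sum_single f, ← Finsupp.sum_single g]
    simp only [Finsupp.sum, map_sum, LinearMap.sum_apply, loopCocycle_single]
    exact Finset.sum_comm
  rw [h]
  refine Finset.sum_eq_zero fun i _ => Finset.sum_eq_zero fun j _ => ?_
  split_ifs with hij
  · rcases lt_or_ge i a with hi | hi
    · rw [hf i hi, map_zero, LinearMap.zero_apply, mul_zero]
    · rw [hg j (by lia), map_zero, mul_zero]
  · rfl

end Loop

section Affine

variable {k : Type u} [Field k] {ι : Type w} {𝔤 : ι → Type v} [∀ i, LieRing (𝔤 i)]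
  [∀ i, LieAlgebra k (𝔤 i)] {ε : ι → kˣ} {σ : ∀ i, 𝔤 i ≃ₗ⁅k⁆ 𝔤 i}

theorem affineFiltration_antitone : Antitone (affineFiltration 𝔤 ε σ) := fun _ _ hrs _ hz i =>
  ⟨fun n hn => (hz i).1 n (hn.trans_le hrs), fun hr => (hz i).2 (hr.trans_le hrs)⟩

theorem lie_mem_affineFiltration {a b : ℤ} {x y : AffineKM 𝔤 ε σ}
    (hx : x ∈ affineFiltration 𝔤 ε σ a) (hy : y ∈ affineFiltration 𝔤 ε σ b) :
    ⁅x, y⁆ ∈ affineFiltration 𝔤 ε σ (a + b) := by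
  intro i
  obtain ⟨hx1, hx2⟩ := hx i
  obtain ⟨hy1, hy2⟩ := hy i
  rw [DirectSum.bracket_apply, LieSubalgebra.coe_bracket]
  refine ⟨fun n hn => ?_, fun hab => ⟨loopCocycle_eq_zero hx1 hy1 hab, rfl⟩⟩
  rw [AffineLie.loop_lie, Finsupp.sub_apply, Finsupp.add_apply, Finsupp.smul_apply,
    Finsupp.smul_apply, loopDeriv_apply, loopDeriv_apply, loopBracket_apply_eq_zero hx1 hy1 hn,
    zero_add]
  -- `d` has degree `0`, so its coefficient vanishes in positive degrees
  have h1 : (x i : AffineLie k (𝔤 i)).d • (n : k) • (y i : AffineLie k (𝔤 i)).loop n = 0 := by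
    rcases lt_or_ge 0 a with ha | ha
    · rw [(hx2 ha).2, zero_smul]
    · rw [hy1 n (by lia), smul_zero, smul_zero]
  have h2 : (y i : AffineLie k (𝔤 i)).d • (n : k) • (x i : AffineLie k (𝔤 i)).loop n = 0 := by
    rcases lt_or_ge 0 b with hb | hb
    · rw [(hy2 hb).2, zero_smul]
    · rw [hx1 n (by lia), smul_zero, smul_zero]
  rw [h1, h2, sub_zero]

theorem exists_mem_affineFiltration [Fintype ι] (z : AffineKM 𝔤 ε σ) :
    ∃ d ≤ 0, z ∈ affineFiltration 𝔤 ε σ d := by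
  classical
  let S : Finset ℤ := insert 0 (Finset.univ.biUnion fun i => (z i : AffineLie k (𝔤 i)).loop.support)
  have hS : S.Nonempty := ⟨0, Finset.mem_insert_self _ _⟩
  have h0 : S.min' hS ≤ 0 := Finset.min'_le _ _ (Finset.mem_insert_self _ _)
  refine ⟨S.min' hS, h0, fun i => ⟨fun n hn => ?_, fun h => absurd h (not_lt.2 h0)⟩⟩
  by_contra hne
  refine absurd hn (not_lt.2 (Finset.min'_le _ _ ?_))
  exact Finset.mem_insert_of_mem
    (Finset.mem_biUnion.2 ⟨i, Finset.mem_univ i, Finsupp.mem_support_iff.2 hne⟩)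

variable (ε σ) in
/-- The coefficient of `t ^ n` in the `i`-th component. -/
noncomputable def loopCoeff (i : ι) (n : ℤ) : AffineKM 𝔤 ε σ →ₗ[k] 𝔤 i where
  toFun z := (z i : AffineLie k (𝔤 i)).loop n
  map_add' z z' := by simp
  map_smul' a z := by simp [DirectSum.smul_apply]

theorem loopCoeff_apply (i : ι) (n : ℤ) (z : AffineKM 𝔤 ε σ) :
    loopCoeff ε σ i n z = (z i : AffineLie k (𝔤 i)).loop n := rfl

theorem loopCoeff_mem (i : ι) (n : ℤ) (z : AffineKM 𝔤 ε σ) :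
    loopCoeff ε σ i n z ∈ twistEigenspace (ε i) (σ i) n := (z i).2 n

variable [DecidableEq ι]

variable (ε σ) in
/-- The homogeneous element `x t ^ n` of the `i`-th component. -/
noncomputable def homogeneous (i : ι) (n : ℤ) :
    twistEigenspace (ε i) (σ i) n →ₗ[k] AffineKM 𝔤 ε σ :=
  DirectSum.lof k ι (fun i => twistedAffine (ε i) (σ i)) i ∘ₗ
    { toFun := fun x => ⟨⟨Finsupp.single n (x : 𝔤 i), 0, 0⟩, fun b => by
        by_cases h : n = b
        · subst h; simpa using mem_twistEigenspace.1 x.2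
        · simp [h]⟩
      map_add' := fun x y => by ext1; ext1 <;> simp
      map_smul' := fun r x => by ext1; ext1 <;> simp }

theorem homogeneous_apply_same (i : ι) (n : ℤ) (x : twistEigenspace (ε i) (σ i) n) :
    (homogeneous ε σ i n x i : AffineLie k (𝔤 i)) = ⟨Finsupp.single n (x : 𝔤 i), 0, 0⟩ := by
  simp [homogeneous, DirectSum.lof_apply]

theorem homogeneous_apply_of_ne {i j : ι} (h : i ≠ j) (n : ℤ)
    (x : twistEigenspace (ε i) (σ i) n) : homogeneous ε σ i n x j = 0 := by
  rw [homogeneous, LinearMap.comp_apply, DirectSum.lof_eq_of]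
  exact DirectSum.of_eq_of_ne _ _ _ h.symm

theorem homogeneous_mem (i : ι) (n : ℤ) (x : twistEigenspace (ε i) (σ i) n) :
    homogeneous ε σ i n x ∈ affineFiltration 𝔤 ε σ n := by
  intro j
  by_cases h : i = j
  · subst h
    rw [homogeneous_apply_same]
    exact ⟨fun b hb => Finsupp.single_eq_of_ne hb.ne, fun _ => ⟨rfl, rfl⟩⟩
  · rw [homogeneous_apply_of_ne h]
    simp

theorem lie_homogeneous (i : ι) {a b c : ℤ} (hab : a + b = c) (hc : c ≠ 0)
    (x : twistEigenspace (ε i) (σ i) a) (y : twistEigenspace (ε i) (σ i) b)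
    (h : ⁅(x : 𝔤 i), (y : 𝔤 i)⁆ ∈ twistEigenspace (ε i) (σ i) c) :
    ⁅homogeneous ε σ i a x, homogeneous ε σ i b y⁆ = homogeneous ε σ i c ⟨_, h⟩ := by
  refine DFinsupp.ext fun j => Subtype.ext ?_
  rw [DirectSum.bracket_apply, LieSubalgebra.coe_bracket]
  by_cases h : i = j
  · subst h
    rw [homogeneous_apply_same, homogeneous_apply_same, homogeneous_apply_same]
    ext1
    · simp [hab]
    · simp [hab, hc]
    · simp
  · rw [homogeneous_apply_of_ne h, homogeneous_apply_of_ne h, homogeneous_apply_of_ne h]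
    simp

/-- The bracket with `y t ^ b` acts on coefficients by `⁅·, y⁆`. Here `n ≠ 0`, because the element
`d` contributes `b y` to the coefficient of `t ^ b`. -/
theorem loopCoeff_lie_homogeneous (i : ι) {n b : ℤ} (hn : n ≠ 0) (z : AffineKM 𝔤 ε σ)
    (y : twistEigenspace (ε i) (σ i) b) :
    loopCoeff ε σ i (n + b) ⁅z, homogeneous ε σ i b y⁆ = ⁅loopCoeff ε σ i n z, (y : 𝔤 i)⁆ := by
  rw [loopCoeff_apply, loopCoeff_apply, DirectSum.bracket_apply, LieSubalgebra.coe_bracket,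
    homogeneous_apply_same, AffineLie.loop_lie]
  have h : b ≠ n + b := fun h => hn (by lia)
  simp [loopBracket_single_apply, h]

/-- Modulo higher terms, the term of degree `r > 0` of the filtration is generated by brackets of
elements of degrees outside `J`, if in each `[𝔤ₐ, 𝔤ᵣ₋ₐ]` the two factors can be realized in
degrees outside `J`. -/
theorem affineFiltration_le_sup_span [Fintype ι] [CharZero k]
    [∀ i, LieAlgebra.IsSimple k (𝔤 i)] {m : ι → ℕ}
    (hm : ∀ i, 0 < m i) (hε : ∀ i, IsPrimitiveRoot (ε i) (m i)) (hσ : ∀ i, (σ i)^[m i] = id)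
    {r : ℕ} {J : Finset ℕ}
    (hJ : ∀ (i : ι) (a : ℤ), ∃ a' b' : ℕ, a' ∉ J ∧ b' ∉ J ∧ a' + b' = r ∧ 0 < r ∧
      (m i : ℤ) ∣ a - a') :
    affineFiltration 𝔤 ε σ r ≤ affineFiltration 𝔤 ε σ (r + 1 : ℕ) ⊔
      Submodule.span k (bracketsAvoiding (fun n : ℕ => affineFiltration 𝔤 ε σ n) J r) := by
  set T := Submodule.span k (bracketsAvoiding (fun n : ℕ => affineFiltration 𝔤 ε σ n) J r)
  have hT : ∀ i (x : twistEigenspace (ε i) (σ i) (r : ℤ)), homogeneous ε σ i r x ∈ T := by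
    rintro i ⟨x, hx⟩
    suffices h : ∃ hx : x ∈ twistEigenspace (ε i) (σ i) (r : ℤ),
        homogeneous ε σ i r ⟨x, hx⟩ ∈ T from h.2
    have h1 := mem_span_lie_twistEigenspace (hm i) (hε i) (hσ i) r hx
    clear hx
    induction h1 using Submodule.span_induction with
    | zero =>
      refine ⟨zero_mem _, ?_⟩
      have := (homogeneous ε σ i (r : ℤ)).map_zero
      exact this ▸ zero_mem T
    | add u v _ _ h h' =>
      obtain ⟨hu, hu'⟩ := h
      obtain ⟨hv, hv'⟩ := h'
      have := (homogeneous ε σ i (r : ℤ)).map_add ⟨u, hu⟩ ⟨v, hv⟩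
      exact ⟨add_mem hu hv, this ▸ add_mem hu' hv'⟩
    | smul c u _ h =>
      obtain ⟨hu, hu'⟩ := h
      have := (homogeneous ε σ i (r : ℤ)).map_smul c ⟨u, hu⟩
      exact ⟨Submodule.smul_mem _ c hu, this ▸ Submodule.smul_mem _ c hu'⟩
    | mem w hw =>
      obtain ⟨a, u, hu, v, hv, rfl⟩ := hw
      obtain ⟨a', b', ha', hb', hab, hr, hdvd⟩ := hJ i a
      rw [twistEigenspace_eq_of_dvd_sub (hε i).pow_eq_one hdvd] at hu
      rw [twistEigenspace_eq_of_dvd_sub (b := b') (hε i).pow_eq_one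
        (by rw [show (r : ℤ) - a - b' = -(a - a') by lia]; exact dvd_neg.2 hdvd)] at hv
      have hab' : (a' : ℤ) + b' = r := by lia
      have h3 : ⁅u, v⁆ ∈ twistEigenspace (ε i) (σ i) (r : ℤ) :=
        hab' ▸ lie_mem_twistEigenspace hu hv
      exact ⟨h3, Submodule.subset_span ⟨a', b', ha', hb', hab, _, homogeneous_mem i _ ⟨u, hu⟩,
        _, homogeneous_mem i _ ⟨v, hv⟩, lie_homogeneous i hab' (by lia) ⟨u, hu⟩ ⟨v, hv⟩ h3⟩⟩
  intro z hz
  have hr : ∀ i : ι, 0 < r := fun i => by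
    obtain ⟨a', b', -, -, -, hr, -⟩ := hJ i 0
    exact hr
  -- `s` is the homogeneous part of `z` of degree `r`
  set s := ∑ i, homogeneous ε σ i r ⟨loopCoeff ε σ i r z, loopCoeff_mem i r z⟩ with hs
  rw [← sub_add_cancel z s]
  refine add_mem (Submodule.mem_sup_left ?_)
    (Submodule.mem_sup_right (sum_mem fun i _ => hT i _))
  have hsi : ∀ i, (s i : AffineLie k (𝔤 i)) =
      ⟨Finsupp.single (r : ℤ) (loopCoeff ε σ i r z), 0, 0⟩ := by
    intro i
    rw [hs, DFinsupp.finsetSum_apply, Finset.sum_eq_single i, homogeneous_apply_same]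
    · exact fun j _ hj => homogeneous_apply_of_ne hj _ _
    · exact fun h => absurd (Finset.mem_univ i) h
  intro i
  rw [DirectSum.sub_apply, AddSubgroupClass.coe_sub, hsi]
  refine ⟨fun n hn => ?_, fun _ => ?_⟩
  · rw [AffineLie.loop_sub, Finsupp.sub_apply]
    rcases eq_or_ne n r with rfl | hne
    · rw [Finsupp.single_eq_same, loopCoeff_apply, sub_self]
    · rw [Finsupp.single_eq_of_ne hne, (hz i).1 n (by lia), sub_zero]
  · have := (hz i).2 (by exact_mod_cast hr i)
    rw [AffineLie.c_sub, AffineLie.d_sub, this.1, this.2]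
    simp

end Affine

/-! ### Leading terms over an extension field -/

section LeadingTerm

variable {k : Type u} [Field k] {K : Type u} [Field K] [Algebra k K]

theorem mem_baseChange_of_map_eq_zero {V W : Type*} [AddCommGroup V] [Module k V]
    [AddCommGroup W] [Module k W] {f : V →ₗ[k] W} {P Q : Submodule k V}
    (h : ∀ z ∈ P, f z = 0 → z ∈ Q) {z : K ⊗[k] V} (hz : z ∈ P.baseChange K)
    (hfz : f.baseChange K z = 0) : z ∈ Q.baseChange K := by
  obtain ⟨z, rfl⟩ := hz
  have h1 : z ∈ LinearMap.ker ((f ∘ₗ P.subtype).baseChange K) := by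
    rw [LinearMap.mem_ker, LinearMap.baseChange_comp]
    exact hfz
  have h2 : (LinearMap.ker (f ∘ₗ P.subtype)).baseChange K ≤
      (Q.baseChange K).comap (P.subtype.baseChange K) := by
    rw [Submodule.baseChange_eq_span, Submodule.span_le]
    rintro _ ⟨y, hy, rfl⟩
    exact Submodule.tmul_mem_baseChange_of_mem _ (h y y.2 hy)
  rw [ker_baseChange] at h1
  exact h2 h1

theorem baseChange_apply_eq_zero {V W : Type*} [AddCommGroup V] [Module k V]
    [AddCommGroup W] [Module k W] {f : V →ₗ[k] W} {Q : Submodule k V}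
    (h : ∀ z ∈ Q, f z = 0) {z : K ⊗[k] V} (hz : z ∈ Q.baseChange K) : f.baseChange K z = 0 := by
  obtain ⟨z, rfl⟩ := hz
  have h1 : f ∘ₗ Q.subtype = 0 := LinearMap.ext fun y => h y y.2
  have h2 := LinearMap.congr_fun (LinearMap.baseChange_comp (A := K) Q.subtype f) z
  rw [h1, LinearMap.baseChange_zero] at h2
  exact h2.symm

variable (K) in
theorem baseChange_lie_tmul {L 𝔥 : Type*} [LieRing L] [LieAlgebra k L] [LieRing 𝔥]
    [LieAlgebra k 𝔥] {f g : L →ₗ[k] 𝔥} {x : L} {y : 𝔥} (h : ∀ z, f ⁅z, x⁆ = ⁅g z, y⁆)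
    (z : K ⊗[k] L) : f.baseChange K ⁅z, (1 : K) ⊗ₜ[k] x⁆ = ⁅g.baseChange K z, (1 : K) ⊗ₜ[k] y⁆ := by
  induction z using TensorProduct.induction_on with
  | zero => simp
  | add z z' h h' => simp [h, h']
  | tmul c z => simp [h]

theorem baseChange_pi_eq_zero {V ι : Type*} [Fintype ι] {W : ι → Type*} [AddCommGroup V]
    [Module k V] [∀ i, AddCommGroup (W i)] [∀ i, Module k (W i)] (f : ∀ i, V →ₗ[k] W i)
    {z : K ⊗[k] V} (h : ∀ i, (f i).baseChange K z = 0) : (LinearMap.pi f).baseChange K z = 0 := by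
  classical
  have h1 : LinearMap.pi f = ∑ i, LinearMap.single k W i ∘ₗ f i := by
    ext v i
    simp [Finset.sum_apply]
  have h2 : (LinearMap.pi f).baseChange K z =
      ∑ i, (LinearMap.single k W i).baseChange K ((f i).baseChange K z) := by
    rw [h1]
    exact (LinearMap.congr_fun (map_sum (LinearMap.baseChangeHom k K V (∀ i, W i)) _ _) z).trans
      (by simp [LinearMap.baseChange_comp])
  rw [h2]
  simp [h]

variable {ι : Type w} {𝔤 : ι → Type v} [∀ i, LieRing (𝔤 i)] [∀ i, LieAlgebra k (𝔤 i)]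
  {ε : ι → kˣ} {σ : ∀ i, 𝔤 i ≃ₗ⁅k⁆ 𝔤 i}

theorem exists_loopCoeff_ne_zero [Fintype ι] {d : ℤ} (hd : d < 0) {z : K ⊗[k] AffineKM 𝔤 ε σ}
    (hz : z ∈ (affineFiltration 𝔤 ε σ d).baseChange K)
    (hz' : z ∉ (affineFiltration 𝔤 ε σ (d + 1)).baseChange K) :
    ∃ i, (loopCoeff ε σ i d).baseChange K z ≠ 0 := by
  by_contra! h
  refine hz' (mem_baseChange_of_map_eq_zero (f := LinearMap.pi fun i => loopCoeff ε σ i d)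
    (P := affineFiltration 𝔤 ε σ d) (Q := affineFiltration 𝔤 ε σ (d + 1))
    (fun y hy hfy => ?_) hz (baseChange_pi_eq_zero _ h))
  refine fun i => ⟨fun n hn => ?_, fun h => by lia⟩
  rcases (Int.lt_add_one_iff.1 hn).lt_or_eq with hn | rfl
  · exact (hy i).1 n hn
  · exact congrFun hfy i

theorem baseChange_loopCoeff_lie [DecidableEq ι] (i : ι) {n b : ℤ} (hn : n ≠ 0)
    (z : K ⊗[k] AffineKM 𝔤 ε σ) (y : twistEigenspace (ε i) (σ i) b) :
    (loopCoeff ε σ i (n + b)).baseChange K ⁅z, (1 : K) ⊗ₜ[k] homogeneous ε σ i b y⁆ =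
      ⁅(loopCoeff ε σ i n).baseChange K z, (1 : K) ⊗ₜ[k] (y : 𝔤 i)⁆ :=
  baseChange_lie_tmul K (fun x => loopCoeff_lie_homogeneous i hn x y) z

/-- A leading coefficient of negative degree is not central, so that its brackets with suitable
`y t^b`, where `b` runs through a residue class, do not vanish. -/
theorem exists_lie_leadingTerm [Fintype ι] [CharZero k] [∀ i, LieAlgebra.IsSimple k (𝔤 i)]
    {m : ι → ℕ} (hm : ∀ i, 0 < m i) (hε : ∀ i, IsPrimitiveRoot (ε i) (m i))
    (hσ : ∀ i, (σ i)^[m i] = id) (N : ℕ) {d : ℤ} (hd : d < 0) {z : K ⊗[k] AffineKM 𝔤 ε σ}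
    (hz : z ∈ (affineFiltration 𝔤 ε σ d).baseChange K)
    (hz' : z ∉ (affineFiltration 𝔤 ε σ (d + 1)).baseChange K) :
    ∃ μ c : ℤ, 0 < μ ∧ μ ≤ (Finset.univ.sup m : ℕ) ∧ 0 ≤ c ∧ c < μ ∧
      ∀ j : ℕ, ∃ y ∈ (affineFiltration 𝔤 ε σ (N + c + j * μ)).baseChange K,
        ⁅z, y⁆ ∈ (affineFiltration 𝔤 ε σ (d + (N + c + j * μ))).baseChange K ∧
        ⁅z, y⁆ ∉ (affineFiltration 𝔤 ε σ (d + (N + c + j * μ) + 1)).baseChange K := by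
  classical
  obtain ⟨i, hi⟩ := exists_loopCoeff_ne_zero hd hz hz'
  obtain ⟨a, y, hy, hya⟩ := exists_lie_tmul_ne_zero (hm i) (hε i) (hσ i) hi
  have hμ : (0 : ℤ) < m i := by exact_mod_cast hm i
  refine ⟨m i, (a - N) % m i, hμ, ?_, Int.emod_nonneg _ hμ.ne', Int.emod_lt_of_pos _ hμ,
    fun j => ?_⟩
  · exact_mod_cast Finset.le_sup (f := m) (Finset.mem_univ i)
  · set b : ℤ := N + (a - N) % m i + j * m i
    have hb : (m i : ℤ) ∣ a - b := by
      refine ⟨(a - N) / m i - j, ?_⟩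
      have := Int.emod_add_mul_ediv (a - N) (m i)
      simp only [b]
      linarith
    rw [twistEigenspace_eq_of_dvd_sub (hε i).pow_eq_one hb] at hy
    have hy' := Submodule.tmul_mem_baseChange_of_mem (A := K) 1
      (homogeneous_mem (ε := ε) (σ := σ) i b ⟨y, hy⟩)
    have hlie := lie_mem_baseChange K (P := affineFiltration 𝔤 ε σ d)
      (Q := affineFiltration 𝔤 ε σ b) (R := affineFiltration 𝔤 ε σ (d + b))
      (fun _ hu _ hv => lie_mem_affineFiltration hu hv) _ hz _ hy'
    refine ⟨_, hy', hlie, fun h => hya ?_⟩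
    rw [← baseChange_loopCoeff_lie i hd.ne z ⟨y, hy⟩]
    exact baseChange_apply_eq_zero (fun x hx => (hx i).1 _ (lt_add_one _)) h

end LeadingTerm

/-! ### The pigeonhole argument for the bound `2 n m` -/

/-- If `J` has at most `n` elements, one of which is `r ≥ 2 n m`, then every residue class modulo
`μ ≤ m` contains an `a'` such that neither `a'` nor `r - a'` is in `J`: the class has `2 n - 1`
members in `[1, r - 1]`, and each of the at most `n - 1` elements of `J` other than `r` excludes
at most two of them. -/
theorem exists_add_eq_notMem {n m μ r : ℕ} {J : Finset ℕ} (hμ : 0 < μ) (hμm : μ ≤ m) (hrJ : r ∈ J)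
    (hJ : J.card ≤ n) (hr : 2 * n * m ≤ r) (a : ℤ) :
    ∃ a' b' : ℕ, a' ∉ J ∧ b' ∉ J ∧ a' + b' = r ∧ 0 < r ∧ (μ : ℤ) ∣ a - a' := by
  have hn : 0 < n := lt_of_lt_of_le (Finset.card_pos.2 ⟨r, hrJ⟩) hJ
  have hμ' : (0 : ℤ) < μ := by exact_mod_cast hμ
  obtain ⟨c, hc⟩ := Int.eq_ofNat_of_zero_le (Int.emod_nonneg (a - 1) hμ'.ne')
  have hcμ : c < μ := by
    have := Int.emod_lt_of_pos (a - 1) hμ'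
    lia
  have hdvd : ∀ j : ℕ, (μ : ℤ) ∣ a - (c + 1 + j * μ : ℕ) := by
    intro j
    refine ⟨(a - 1) / μ - j, ?_⟩
    have := Int.emod_add_mul_ediv (a - 1) μ
    push_cast
    linarith
  have hlt : ∀ j < 2 * n - 1, c + 1 + j * μ < r := by
    intro j hj
    have h1 : (j + 2) * μ ≤ 2 * n * m := Nat.mul_le_mul (by lia) hμm
    have h2 : (j + 2) * μ = j * μ + 2 * μ := by ring
    lia
  by_contra! hcon
  have hinj : ∀ j j' : ℕ, j * μ = j' * μ → j = j' := fun j j' h => Nat.eq_of_mul_eq_mul_right hμ h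
  have hsub : Finset.range (2 * n - 1) ⊆
      ((Finset.range (2 * n - 1)).filter fun j => c + 1 + j * μ ∈ J.erase r) ∪
      ((Finset.range (2 * n - 1)).filter fun j => r - (c + 1 + j * μ) ∈ J.erase r) := by
    intro j hj
    have hjr := hlt j (Finset.mem_range.1 hj)
    rw [Finset.mem_union, Finset.mem_filter, Finset.mem_filter, Finset.mem_erase,
      Finset.mem_erase]
    by_cases h : c + 1 + j * μ ∈ J
    · exact Or.inl ⟨hj, hjr.ne, h⟩
    · refine Or.inr ⟨hj, by lia, ?_⟩
      by_contra h'
      exact hcon _ _ h h' (by lia) (by lia) (hdvd j)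
  have hA : ((Finset.range (2 * n - 1)).filter fun j => c + 1 + j * μ ∈ J.erase r).card ≤
      (J.erase r).card :=
    Finset.card_le_card_of_injOn (fun j => c + 1 + j * μ)
      (fun j hj => (Finset.mem_filter.1 hj).2) fun j _ j' _ h => hinj j j' (by
        simp only at h
        lia)
  have hB : ((Finset.range (2 * n - 1)).filter fun j =>
      r - (c + 1 + j * μ) ∈ J.erase r).card ≤ (J.erase r).card :=
    Finset.card_le_card_of_injOn (fun j => r - (c + 1 + j * μ))
      (fun j hj => (Finset.mem_filter.1 hj).2) fun j hj j' hj' h => hinj j j' (by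
        have h1 := hlt j (Finset.mem_range.1 (Finset.mem_filter.1 hj).1)
        have h2 := hlt j' (Finset.mem_range.1 (Finset.mem_filter.1 hj').1)
        simp only at h
        lia)
  have h1 := (Finset.card_le_card hsub).trans (Finset.card_union_le _ _)
  rw [Finset.card_range] at h1
  rw [Finset.card_erase_of_mem hrJ] at hA hB
  lia

/-! ### Finite codimension of the terms of the filtration -/

section Finite

variable {k : Type u} [Field k] {ι : Type w} {𝔤 : ι → Type v} [∀ i, LieRing (𝔤 i)]
  [∀ i, LieAlgebra k (𝔤 i)] {ε : ι → kˣ} {σ : ∀ i, 𝔤 i ≃ₗ⁅k⁆ 𝔤 i}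

variable (𝔤 ε σ) in
/-- The coefficients of degrees in `[-l, l)` and those of the elements `cᵢ` and `dᵢ`. -/
noncomputable def truncate (l : ℕ) : AffineKM 𝔤 ε σ →ₗ[k]
    ∀ i, (Finset.Ico (-l : ℤ) l → 𝔤 i) × k × k where
  toFun z i := (fun n => (z i : AffineLie k (𝔤 i)).loop n, (z i : AffineLie k (𝔤 i)).c,
    (z i : AffineLie k (𝔤 i)).d)
  map_add' z z' := by
    ext i <;> simp
  map_smul' a z := by
    ext i <;> simp [DirectSum.smul_apply]

theorem mem_affineFiltration_of_truncate_eq_zero {l : ℕ} {z : AffineKM 𝔤 ε σ}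
    (hz : z ∈ affineFiltration 𝔤 ε σ (-l)) (h : truncate 𝔤 ε σ l z = 0) :
    z ∈ affineFiltration 𝔤 ε σ l := by
  intro i
  have hi := congrFun h i
  refine ⟨fun n hn => ?_, fun _ => ⟨congrArg (fun p => p.2.1) hi, congrArg (fun p => p.2.2) hi⟩⟩
  rcases lt_or_ge n (-l) with hn' | hn'
  · exact (hz i).1 n hn'
  · exact congrFun (congrArg Prod.fst hi) ⟨n, Finset.mem_Ico.2 ⟨hn', hn⟩⟩

variable [Fintype ι] [∀ i, FiniteDimensional k (𝔤 i)]

theorem finite_affineFiltration_quotient (l : ℕ) :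
    FiniteDimensional k (affineFiltration 𝔤 ε σ (-l) ⧸
      (affineFiltration 𝔤 ε σ l).submoduleOf (affineFiltration 𝔤 ε σ (-l))) :=
  finite_quotient_of_ker_le (truncate 𝔤 ε σ l)
    fun _ hz h => mem_affineFiltration_of_truncate_eq_zero hz h

theorem finite_affinePositiveFiltration_quotient (l : ℕ) :
    FiniteDimensional k ((⊤ : Submodule k (affinePositivePart 𝔤 ε σ)) ⧸
      (affinePositiveFiltration 𝔤 ε σ l).submoduleOf ⊤) :=
  finite_quotient_of_ker_le
    (truncate 𝔤 ε σ l ∘ₗ (affinePositivePart 𝔤 ε σ).toSubmodule.subtype) fun z _ h =>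
      mem_affineFiltration_of_truncate_eq_zero (z := (z : AffineKM 𝔤 ε σ))
        (affineFiltration_antitone (by lia : -(l : ℤ) ≤ 0) z.2) h

end Finite

/-! ### Subalgebras of finite codimension -/

section Codimension

variable {k : Type u} [Field k] [CharZero k] {ι : Type w} [Fintype ι] {𝔤 : ι → Type v}
  [∀ i, LieRing (𝔤 i)] [∀ i, LieAlgebra k (𝔤 i)] [∀ i, LieAlgebra.IsSimple k (𝔤 i)]
  {m : ι → ℕ} (hm : ∀ i, 0 < m i) {ε : ι → kˣ} (hε : ∀ i, IsPrimitiveRoot (ε i) (m i))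
  {σ : ∀ i, 𝔤 i ≃ₗ⁅k⁆ 𝔤 i} (hσ : ∀ i, (σ i)^[m i] = id)
include hm hε hσ

theorem affineFiltration_le_sup_span_of_card_le {n r : ℕ} {J : Finset ℕ} (hrJ : r ∈ J)
    (hJ : J.card ≤ n) (hr : 2 * n * Finset.univ.sup m ≤ r) :
    affineFiltration 𝔤 ε σ r ≤ affineFiltration 𝔤 ε σ (r + 1 : ℕ) ⊔
      Submodule.span k (bracketsAvoiding (fun n : ℕ => affineFiltration 𝔤 ε σ n) J r) := by
  classical
  exact affineFiltration_le_sup_span hm hε hσ fun i a =>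
    exists_add_eq_notMem (hm i) (Finset.le_sup (Finset.mem_univ i)) hrJ hJ hr a

theorem affinePositiveFiltration_le_sup_span_of_card_le {n r : ℕ} {J : Finset ℕ} (hrJ : r ∈ J)
    (hJ : J.card ≤ n) (hr : 2 * n * Finset.univ.sup m ≤ r) :
    affinePositiveFiltration 𝔤 ε σ r ≤ affinePositiveFiltration 𝔤 ε σ (r + 1) ⊔
      Submodule.span k (bracketsAvoiding (affinePositiveFiltration 𝔤 ε σ) J r) := by
  have h0 : ∀ n : ℕ, affineFiltration 𝔤 ε σ n ≤ (affinePositivePart 𝔤 ε σ).toSubmodule :=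
    fun n => affineFiltration_antitone (Int.natCast_nonneg n)
  have h1 : affineFiltration 𝔤 ε σ (r + 1 : ℕ) ⊔
      Submodule.span k (bracketsAvoiding (fun n : ℕ => affineFiltration 𝔤 ε σ n) J r) ≤
      (affinePositiveFiltration 𝔤 ε σ (r + 1) ⊔
        Submodule.span k (bracketsAvoiding (affinePositiveFiltration 𝔤 ε σ) J r)).map
          (affinePositivePart 𝔤 ε σ).toSubmodule.subtype := by
    refine sup_le (fun y hy => ⟨⟨y, h0 _ hy⟩, Submodule.mem_sup_left hy, rfl⟩)
      (Submodule.span_le.2 ?_)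
    rintro _ ⟨a, b, ha, hb, hab, x, hx, y, hy, rfl⟩
    exact ⟨⁅(⟨x, h0 a hx⟩ : affinePositivePart 𝔤 ε σ), ⟨y, h0 b hy⟩⁆,
      Submodule.mem_sup_right (Submodule.subset_span
        ⟨a, b, ha, hb, hab, ⟨x, h0 a hx⟩, hx, ⟨y, h0 b hy⟩, hy, rfl⟩), rfl⟩
  intro x hx
  obtain ⟨x', hx', hxx'⟩ :=
    h1 (affineFiltration_le_sup_span_of_card_le hm hε hσ hrJ hJ hr (x := (x : AffineKM 𝔤 ε σ)) hx)
  rwa [← Subtype.ext hxx']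

theorem affinePositiveFiltration_le_of_mem_codimPart {n : ℕ} {K : Type u} [Field K] [Algebra k K]
    [FiniteDimensional k K] {H : LieSubalgebra K (K ⊗[k] affinePositivePart 𝔤 ε σ)}
    (hH : H ∈ codimPart (closedSubalgebras (affinePositiveFiltration 𝔤 ε σ)) n K) :
    (affinePositiveFiltration 𝔤 ε σ (2 * n * Finset.univ.sup m)).baseChange K ≤
      H.toSubmodule := by
  obtain ⟨hcl, hn⟩ := hH
  have htop : (affinePositiveFiltration 𝔤 ε σ 0).baseChange K = ⊤ := by
    rw [← Submodule.baseChange_top]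
    congr 1
    exact eq_top_iff.2 fun z _ => z.2
  have hquot : ∀ N : Submodule K (K ⊗[k] affinePositivePart 𝔤 ε σ), N = ⊤ →
      Module.rank K (N ⧸ H.toSubmodule.submoduleOf N) = n := by
    rintro _ rfl
    rw [← hn]
    refine LinearEquiv.rank_eq (Submodule.Quotient.equiv _ _ Submodule.topEquiv ?_)
    ext z
    simp [Submodule.submoduleOf]
  refine filtration_le_of_rank_le (G := fun r => (affinePositiveFiltration 𝔤 ε σ r).baseChange K)
    (n := n)
    (fun a b hab => Submodule.baseChange_mono K fun z hz =>
      affineFiltration_antitone (by exact_mod_cast hab : (a : ℤ) ≤ b) hz)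
    (fun a b => lie_mem_baseChange K fun x hx y hy => ?_)
    (fun r J hrJ hJ hr => baseChange_le_sup_span_bracketsAvoiding K
      (affinePositiveFiltration_le_sup_span_of_card_le hm hε hσ hrJ hJ hr))
    (le_of_eq hcl) (hquot _ htop).le
  have := lie_mem_affineFiltration (x := (x : AffineKM 𝔤 ε σ)) (y := y) hx hy
  rwa [← Nat.cast_add] at this

theorem affineFiltration_le_of_mem_relCodimPart {n : ℕ} {K : Type u} [Field K] [Algebra k K]
    [FiniteDimensional k K] {H : LieSubalgebra K (K ⊗[k] AffineKM 𝔤 ε σ)}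
    (hH : H ∈ relCodimPart (affineFiltration 𝔤 ε σ) (commensurableIn (affineFiltration 𝔤 ε σ)
      (closedSubalgebras (affineFiltration 𝔤 ε σ))) n K) :
    (affineFiltration 𝔤 ε σ ((2 * n * Finset.univ.sup m : ℕ) : ℤ)).baseChange K ≤
      H.toSubmodule := by
  obtain ⟨⟨hcl, -⟩, hn⟩ := hH
  refine filtration_le_of_rank_le (G := fun r : ℕ => (affineFiltration 𝔤 ε σ r).baseChange K)
    (n := n)
    (fun a b hab => Submodule.baseChange_mono K (affineFiltration_antitone (by exact_mod_cast hab)))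
    (fun a b => lie_mem_baseChange K fun x hx y hy => ?_)
    (fun r J hrJ hJ hr => baseChange_le_sup_span_bracketsAvoiding K
      (F := fun r : ℕ => affineFiltration 𝔤 ε σ r)
      (affineFiltration_le_sup_span_of_card_le hm hε hσ hrJ hJ hr))
    (le_trans (le_iInf fun j : ℤ => ?_) (le_of_eq hcl)) (hn ▸ self_le_add_left _ _)
  · have := lie_mem_affineFiltration hx hy
    rwa [← Nat.cast_add] at this
  · exact (iInf_le _ j.toNat).trans (sup_le_sup_left (Submodule.baseChange_mono K
      (affineFiltration_antitone (Int.self_le_toNat j))) _)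

theorem le_affineFiltration_of_mem_relCodimPart {n : ℕ} {K : Type u} [Field K] [Algebra k K]
    [FiniteDimensional k K] {H : LieSubalgebra K (K ⊗[k] AffineKM 𝔤 ε σ)}
    (hH : H ∈ relCodimPart (affineFiltration 𝔤 ε σ) (commensurableIn (affineFiltration 𝔤 ε σ)
      (closedSubalgebras (affineFiltration 𝔤 ε σ))) n K) :
    H.toSubmodule ≤ (affineFiltration 𝔤 ε σ (-(2 * n * Finset.univ.sup m +
      (n + 1) * Finset.univ.sup m : ℕ))).baseChange K := by
  refine le_filtration_of_rank_le (G := fun r : ℤ => (affineFiltration 𝔤 ε σ r).baseChange K)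
    (fun a b hab => Submodule.baseChange_mono K (affineFiltration_antitone hab)) (fun z => ?_)
    (affineFiltration_le_of_mem_relCodimPart hm hε hσ hH)
    (fun z d hd hz hz' => exists_lie_leadingTerm hm hε hσ _ hd hz hz')
    (hH.2 ▸ self_le_add_right _ _)
  induction z using TensorProduct.induction_on with
  | zero => exact ⟨0, zero_mem _⟩
  | tmul c x =>
    obtain ⟨d, -, hd⟩ := exists_mem_affineFiltration x
    exact ⟨d, Submodule.tmul_mem_baseChange_of_mem c hd⟩
  | add z z' h h' =>
    obtain ⟨d, hd⟩ := h
    obtain ⟨d', hd'⟩ := h'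
    exact ⟨min d d', add_mem
      (Submodule.baseChange_mono K (affineFiltration_antitone (min_le_left d d')) hd)
      (Submodule.baseChange_mono K (affineFiltration_antitone (min_le_right d d')) hd')⟩

end Codimension

/-! ### Stability from uniform bounds -/

section Stable

variable {k : Type u} [Field k] {L : Type v} [LieRing L] [LieAlgebra k L]

theorem isStableClass_of_forall_le {F : ℕ → Submodule k L} (hF : Antitone F)
    {X : SubalgebraClass k L}
    (hX : ∀ l n : ℕ, IsConstructibleFamily (grassmannianPoints (F l) ⊤ (codimPart X n)))
    (h : ∀ n : ℕ, ∃ l : ℕ, ∀ (K : Type u) [Field K] [Algebra k K] [FiniteDimensional k K],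
      ∀ H ∈ codimPart X n K, (F l).baseChange K ≤ H.toSubmodule) : IsStableClass F X := by
  refine ⟨hX, fun n => ?_⟩
  obtain ⟨l, hl⟩ := h n
  have key : ∀ j ≥ l, ∀ (K : Type u) [Field K] [Algebra k K] [FiniteDimensional k K],
      between (F j) ⊤ (codimPart X n) K = codimPart X n K := fun j hj K _ _ _ =>
    Set.Subset.antisymm (fun H hH => hH.1) fun H hH =>
      ⟨hH, (Submodule.baseChange_mono K (hF hj)).trans (hl K H hH), by simp⟩
  exact ⟨l, fun j hj K _ _ _ => (key j hj K).trans (key l le_rfl K).symm⟩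

theorem isStableClassZ_of_forall_le {F : ℤ → Submodule k L} (hF : Antitone F)
    {X : SubalgebraClass k L}
    (hX : ∀ l n : ℕ, IsConstructibleFamily (grassmannianPoints (F l) (F (-l)) (relCodimPart F X n)))
    (h : ∀ n : ℕ, ∃ l : ℕ, ∀ (K : Type u) [Field K] [Algebra k K] [FiniteDimensional k K],
      ∀ H ∈ relCodimPart F X n K, (F l).baseChange K ≤ H.toSubmodule ∧
        H.toSubmodule ≤ (F (-l)).baseChange K) : IsStableClassZ F X := by
  refine ⟨hX, fun n => ?_⟩
  obtain ⟨l, hl⟩ := h n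
  have key : ∀ j : ℕ, l ≤ j → ∀ (K : Type u) [Field K] [Algebra k K] [FiniteDimensional k K],
      between (F j) (F (-j)) (relCodimPart F X n) K = relCodimPart F X n K := fun j hj K _ _ _ =>
    Set.Subset.antisymm (fun H hH => hH.1) fun H hH =>
      ⟨hH, (Submodule.baseChange_mono K (hF (by lia))).trans (hl K H hH).1,
        (hl K H hH).2.trans (Submodule.baseChange_mono K (hF (by lia)))⟩
  exact ⟨l, fun j hj K _ _ _ => (key j hj K).trans (key l le_rfl K).symm⟩

end Stable

theorem mainTheorem2 {k : Type u} [Field k] [CharZero k] {ι : Type w} [Fintype ι]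
    (𝔤 : ι → Type v) [∀ i, LieRing (𝔤 i)] [∀ i, LieAlgebra k (𝔤 i)]
    [∀ i, FiniteDimensional k (𝔤 i)] [∀ i, LieAlgebra.IsSimple k (𝔤 i)]
    (m : ι → ℕ) (hm : ∀ i, 0 < m i)
    (ε : ι → kˣ) (hε : ∀ i, IsPrimitiveRoot (ε i) (m i))
    (σ : ∀ i, 𝔤 i ≃ₗ⁅k⁆ 𝔤 i) (hσ : ∀ i, (σ i)^[m i] = id)
    (hL : ∀ I : LieIdeal k (AffineKM 𝔤 ε σ), IsLieAbelian (AffineKM 𝔤 ε σ ⧸ I) →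
      FiniteDimensional k (AffineKM 𝔤 ε σ ⧸ I)) :
    IsStableClass (affinePositiveFiltration 𝔤 ε σ)
      (closedSubalgebras (affinePositiveFiltration 𝔤 ε σ)) ∧
    IsStableClass (affinePositiveFiltration 𝔤 ε σ)
      (closedIdeals (affinePositiveFiltration 𝔤 ε σ)) ∧
    IsStableClassZ (affineFiltration 𝔤 ε σ)
      (commensurableIn (affineFiltration 𝔤 ε σ) (closedSubalgebras (affineFiltration 𝔤 ε σ))) ∧
    IsStableClassZ (affineFiltration 𝔤 ε σ)
      (commensurableIn (affineFiltration 𝔤 ε σ) (closedIdeals (affineFiltration 𝔤 ε σ))) ∧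
    ∀ (n : ℕ) (K : Type u) [Field K] [Algebra k K] [FiniteDimensional k K],
      (∀ H ∈ codimPart (closedSubalgebras (affinePositiveFiltration 𝔤 ε σ)) n K,
        (affinePositiveFiltration 𝔤 ε σ (2 * n * Finset.univ.sup m)).baseChange K ≤
          H.toSubmodule) ∧
      (∀ H ∈ relCodimPart (affineFiltration 𝔤 ε σ)
          (commensurableIn (affineFiltration 𝔤 ε σ)
            (closedSubalgebras (affineFiltration 𝔤 ε σ))) n K,
        (affineFiltration 𝔤 ε σ ((2 * n * Finset.univ.sup m : ℕ) : ℤ)).baseChange K ≤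
          H.toSubmodule) := by
  have hF' : Antitone (affinePositiveFiltration 𝔤 ε σ) := fun a b hab z hz =>
    affineFiltration_antitone (by exact_mod_cast hab : (a : ℤ) ≤ b) hz
  have hZ : ∀ n : ℕ, ∃ l : ℕ, ∀ (K : Type u) [Field K] [Algebra k K] [FiniteDimensional k K],
      ∀ H ∈ relCodimPart (affineFiltration 𝔤 ε σ) (commensurableIn (affineFiltration 𝔤 ε σ)
        (closedSubalgebras (affineFiltration 𝔤 ε σ))) n K,
      (affineFiltration 𝔤 ε σ l).baseChange K ≤ H.toSubmodule ∧
        H.toSubmodule ≤ (affineFiltration 𝔤 ε σ (-l)).baseChange K := fun n =>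
    ⟨2 * n * Finset.univ.sup m + (n + 1) * Finset.univ.sup m, fun K _ _ _ H hH =>
      ⟨(Submodule.baseChange_mono K (affineFiltration_antitone (by lia))).trans
        (affineFiltration_le_of_mem_relCodimPart hm hε hσ hH),
        le_affineFiltration_of_mem_relCodimPart hm hε hσ hH⟩⟩
  refine ⟨isStableClass_of_forall_le hF' (fun l n => isConstructibleFamily_closedSubalgebras l n
      (finite_affinePositiveFiltration_quotient l)) fun n => ⟨_, fun K _ _ _ H hH =>
        affinePositiveFiltration_le_of_mem_codimPart hm hε hσ hH⟩,
    isStableClass_of_forall_le hF' (fun l n => isConstructibleFamily_closedIdeals l n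
      (finite_affinePositiveFiltration_quotient l)) fun n => ⟨_, fun K _ _ _ H hH =>
        affinePositiveFiltration_le_of_mem_codimPart hm hε hσ ⟨hH.1.1, hH.2⟩⟩,
    isStableClassZ_of_forall_le affineFiltration_antitone (fun l n =>
      isConstructibleFamily_commensurable_closedSubalgebras affineFiltration_antitone l n
        (finite_affineFiltration_quotient l)) hZ,
    isStableClassZ_of_forall_le affineFiltration_antitone (fun l n =>
      isConstructibleFamily_commensurable_closedIdeals affineFiltration_antitone l n
        (finite_affineFiltration_quotient l)) fun n => ?_,
    fun n K _ _ _ => ⟨fun H hH => affinePositiveFiltration_le_of_mem_codimPart hm hε hσ hH,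
      fun H hH => affineFiltration_le_of_mem_relCodimPart hm hε hσ hH⟩⟩
  obtain ⟨l, hl⟩ := hZ n
  exact ⟨l, fun K _ _ _ H hH => hl K H ⟨⟨hH.1.1.1, hH.1.2⟩, hH.2⟩⟩
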